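/- Let $\mathbb D=\{|w|<1\}$ and $\mathbb T=\{|w|=1\}$. Let $\mathbf H^\infty$ be the set of bounded analytic functions $G:\mathbb D\to\mathbb C$ with $G(\bar w)=\overline{G(w)}$, let $\mathbf A\subset\mathbf H^\infty$ be the subset of functions that extend continuously to $\mathbb D\cup\mathbb T$ (and are viewed as functions there), and let $\mathbf{RA}\subset\mathbf A$ be the subset of rational functions. $\mathbf H^\infty_{2\times2}$ and $\mathbf{RA}_{2\times2}$ are the sets of $2\times2$ matrix functions with entries in these classes, $\mathcal D$ is the set of diagonal ones, and $\|G\|_\infty=\sup_{w\in\mathbb D}\sigma_{\max}(G(w))$, where $\sigma_{\max}$ is the largest singular value. Let $J_2=\begin{bmatrix}0&1\\1&0\end{bmatrix}$. For $\gamma>1$ let $\alpha=\arccos(1/\gamma)\in(0,\pi/2)$ and, with principal powers, \[F_\gamma(w)=i\tan(\alpha)\,\frac{1-\left(\frac{1+iw}{1-iw}\right)^{2\alpha/\pi}}{1+\left(\frac{1+iw}{1-iw}\right)^{2\alpha/\pi}}\qquad(w\in\mathbb D).\] Theorem. Let $a,b\in\mathbf{RA}$ be such that $b(w)\ne0$ for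 all $w\in\mathbb T$, and $a+bq$ is not constant for every $q\in\mathbf{RA}$. Put $L_0=I_2+aJ_2$ and $L_1=bJ_2$. Then there is $\gamma>1$ such that \[\inf_{Q\in\mathbf{RA}_{2\times2}\cap\mathcal D}\|L_0+L_1Q\|_\infty=\min_{Q\in\mathbf H^\infty_{2\times2}\cap\mathcal D}\|L_0+L_1Q\|_\infty=\gamma,\] where the minimum is attained, and the only $Q_*\in\mathbf H^\infty_{2\times2}\cap\mathcal D$ with $\|L_0+L_1Q_*\|_\infty=\gamma$ is $Q_*=S_*I_2$, where $S_*\in\mathbf A$ satisfies $a(w)+b(w)S_*(w)=F_\gamma(p(w))$ for all $w\in\mathbb D$, for some non-constant $p\in\mathbf{RA}$ with $|p(w)|=1$ for all $w\in\mathbb T$. -/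

import Mathlib

open Metric Polynomial

noncomputable section

/-- `InHinf f`: the restriction of `f` to the open unit disc belongs to the real `H^∞`, i.e. it is
analytic, bounded and real symmetric there. -/
def InHinf (f : ℂ → ℂ) : Prop :=
  DifferentiableOn ℂ f (ball 0 1) ∧
    (∃ C : ℝ, ∀ w ∈ ball (0 : ℂ) 1, ‖f w‖ ≤ C) ∧
    ∀ w ∈ ball (0 : ℂ) 1, f ((starRingEnd ℂ) w) = (starRingEnd ℂ) (f w)

/-- `InA f`: `f`, viewed as a function on the closed unit disc, is the continuous extension of a
function of class `H^∞`. -/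
def InA (f : ℂ → ℂ) : Prop :=
  InHinf f ∧ ContinuousOn f (closedBall 0 1)

/-- `InRA f`: `f` is of class `A` and is a rational function `P / R` on the unit disc. -/
def InRA (f : ℂ → ℂ) : Prop :=
  InA f ∧ ∃ P R : ℂ[X], R ≠ 0 ∧ ∀ w ∈ ball (0 : ℂ) 1, f w * R.eval w = P.eval w

/-- Matrix-valued functions with all entries of class `H^∞`. -/
def InHinfMat {m k : ℕ} (G : ℂ → Matrix (Fin m) (Fin k) ℂ) : Prop :=
  ∀ i r, InHinf fun w => G w i r

/-- Matrix-valued functions with all entries of class `RA`. -/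
def InRAMat {m k : ℕ} (G : ℂ → Matrix (Fin m) (Fin k) ℂ) : Prop :=
  ∀ i r, InRA fun w => G w i r

/-- `G` takes diagonal values on the unit disc. -/
def DiagOnDisc {n : ℕ} (G : ℂ → Matrix (Fin n) (Fin n) ℂ) : Prop :=
  ∀ w ∈ ball (0 : ℂ) 1, (G w).IsDiag

/-- The largest singular value of a matrix. -/
def sigmaMax {m k : ℕ} (M : Matrix (Fin m) (Fin k) ℂ) : ℝ :=
  (Matrix.toEuclideanLin M).singularValues 0

/-- The largest singular value is the operator norm for the Euclidean norms. -/
theorem sigmaMax_eq_opNorm {m k : ℕ} (M : Matrix (Fin m) (Fin k) ℂ) :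
    sigmaMax M = ‖LinearMap.toContinuousLinearMap (Matrix.toEuclideanLin M)‖ := by
  unfold sigmaMax
  set T := Matrix.toEuclideanLin M with hT
  have hfin : Module.finrank ℂ (EuclideanSpace ℂ (Fin k)) = k := by simp
  have key : ∀ v, (inner ℂ ((LinearMap.adjoint T ∘ₗ T) v) v : ℂ) = ((‖T v‖ ^ 2 : ℝ) : ℂ) := by
    intro v
    rw [LinearMap.comp_apply, LinearMap.adjoint_inner_left, inner_self_eq_norm_sq_to_K]
    norm_cast
  apply le_antisymm
  · by_cases hk : 0 < k
    · obtain ⟨v, hv⟩ := (T.hasEigenvalue_adjoint_comp_self_sq_singularValues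
        (n := 0) (by rw [hfin]; exact hk)).exists_hasEigenvector
      have h1 := key v
      rw [hv.apply_eq_smul, inner_smul_left, inner_self_eq_norm_sq_to_K] at h1
      have h2 : (T.singularValues 0) ^ 2 * ‖v‖ ^ 2 = ‖T v‖ ^ 2 := by
        have : (((T.singularValues 0) ^ 2 * ‖v‖ ^ 2 : ℝ) : ℂ) = ((‖T v‖ ^ 2 : ℝ) : ℂ) := by
          rw [← h1]; simp
        exact_mod_cast this
      have hvpos : 0 < ‖v‖ := norm_pos_iff.mpr hv.2
      have h3 : T.singularValues 0 * ‖v‖ = ‖T v‖ := by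
        rw [← mul_pow] at h2
        exact (sq_eq_sq₀ (mul_nonneg (T.singularValues_nonneg 0) hvpos.le)
          (norm_nonneg _)).mp h2
      have h4 := (LinearMap.toContinuousLinearMap T).le_opNorm v
      rw [LinearMap.coe_toContinuousLinearMap', ← h3] at h4
      exact le_of_mul_le_mul_right h4 hvpos
    · rw [T.singularValues_of_finrank_le (by rw [hfin]; omega)]
      exact norm_nonneg _
  · refine ContinuousLinearMap.opNorm_le_bound _ (T.singularValues_nonneg 0) fun v => ?_
    rw [LinearMap.coe_toContinuousLinearMap']
    refine le_of_sq_le_sq ?_ (mul_nonneg (T.singularValues_nonneg 0) (norm_nonneg v))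
    have hS := T.isSymmetric_adjoint_comp_self
    set e := hS.eigenvectorBasis hfin with he
    have h1 : (‖T v‖ ^ 2 : ℝ) = ∑ i : Fin k, T.singularValues i ^ 2 * ‖inner ℂ (e i) v‖ ^ 2 := by
      have h2 := key v
      rw [← e.sum_inner_mul_inner] at h2
      have h3 : ∀ i, (inner ℂ ((LinearMap.adjoint T ∘ₗ T) v) (e i) : ℂ) * inner ℂ (e i) v =
          ((T.singularValues i ^ 2 * ‖inner ℂ (e i) v‖ ^ 2 : ℝ) : ℂ) := by
        intro i
        rw [hS v (e i), he, hS.apply_eigenvectorBasis hfin i, ← T.sq_singularValues_fin hfin i,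
          inner_smul_right, ← inner_conj_symm v, mul_assoc, Complex.conj_mul']
        push_cast
        rfl
      rw [Finset.sum_congr rfl fun i _ => h3 i] at h2
      exact_mod_cast h2.symm
    rw [h1, mul_pow, ← e.sum_sq_norm_inner_right v, Finset.mul_sum]
    refine Finset.sum_le_sum fun i _ => ?_
    have := T.singularValues_antitone (Nat.zero_le i)
    have h0 := T.singularValues_nonneg i
    gcongr

/-- The norm `‖G‖_∞`, the supremum of the largest singular value over the open unit disc. -/
def hinfNorm {m k : ℕ} (G : ℂ → Matrix (Fin m) (Fin k) ℂ) : ℝ :=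
  sSup ((fun w => sigmaMax (G w)) '' ball (0 : ℂ) 1)

/-- The order reversal matrix `J_n` (rows and columns are counted from `0` here, so the condition
`i + r = n + 1` reads as below). -/
def orderReversal (n : ℕ) : Matrix (Fin n) (Fin n) ℂ :=
  Matrix.of fun i r => if (i : ℕ) + (r : ℕ) + 1 = n then 1 else 0

/-- The conformal map `F_γ` from the open unit disc onto the lens `|1 - s| < γ`, `|1 + s| < γ`,
with `γ = 1 / cos α`, `0 < α < π / 2`, i.e. `α = arccos (1 / γ)`, for `γ > 1`. The power is the
principal one. -/
def lensMap (γ : ℝ) (w : ℂ) : ℂ :=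
  let α : ℝ := Real.arccos (1 / γ)
  let y : ℂ := ((1 + Complex.I * w) / (1 - Complex.I * w)) ^ ((2 * α / Real.pi : ℝ) : ℂ)
  Complex.I * (Real.tan α : ℂ) * ((1 - y) / (1 + y))

end

noncomputable section

open scoped ComplexConjugate Topology
open Filter

/-! For diagonal `Q` the matrix `L₀ + L₁ Q` has ones on the diagonal and the entries `a + b * Q 0
0`, `a + b * Q 1 1` off it. Testing it on (1, 1) and (1, -1) and averaging the two entries shows
that f = a + b (Q 0 0 + Q 1 1) / 2 satisfies |1 ± f| ≤ ‖L₀ + L₁ Q‖ (`isFeasible_hinfNorm`); for `Q =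
S • 1` the norm is at most any level c with |1 ± f| ≤ c (`hinfNorm_le`). So the problem is scalar:
find the least γ for which some a + b q maps the disc into the closed lens |1 ± s| ≤ γ. A normal
family argument gives a minimizer (`exists_minimizer`).

Non-constancy forces γ > 1 and puts f = a + b q in the open lens, so g = F_γ⁻¹ ∘ f is a self-map of
the disc. Changing q by multiples of the denominator of b changes f by multiples of its numerator P.
The Schur algorithm at the zeros of P (`schur_dichotomy`) leaves two cases. Either g is congruent
modulo P to some h with sup |h| < 1; then F_γ ∘ h is an admissible f of smaller level, which is
impossible. Or g is rational inner, and this is the required p (`minimizer_eq_lensMap_comp`).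

Consequently, at every point of the circle |1 + f| or |1 - f| has boundary value γ. If f + d and f -
d are both optimal, the parallelogram law gives |1 ± f|² + |d|² ≤ γ², so d tends to 0 at the circle
and vanishes: this is uniqueness (`eq_of_mean_square_le`). Finally F_γ is continuous up to the
circle, hence so is the minimizer, and real polynomials approximate it uniformly; this gives the
infimum over `RA`. -/

/-! ### Möbius estimates and the Schur algorithm modulo a polynomial. -/

theorem norm_sq_moebius (c X Y : ℂ) :
    ‖Y + conj c * X‖ ^ 2 - ‖X + c * Y‖ ^ 2 = (1 - ‖c‖ ^ 2) * (‖Y‖ ^ 2 - ‖X‖ ^ 2) := by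
  simp only [← Complex.normSq_eq_norm_sq, Complex.normSq_apply, Complex.add_re, Complex.add_im,
    Complex.mul_re, Complex.mul_im, Complex.conj_re, Complex.conj_im]
  ring

/-- Homogeneous in (X, Y), so numerators and denominators can be inserted without dividing. -/
theorem norm_moebius_le {c X Y : ℂ} (hc : ‖c‖ ≤ 1) (h : ‖X‖ ≤ ‖Y‖) :
    ‖X + c * Y‖ ≤ ‖Y + conj c * X‖ := by
  have h1 := norm_sq_moebius c X Y
  have h2 : 0 ≤ 1 - ‖c‖ ^ 2 := by nlinarith [norm_nonneg c]
  have h3 : 0 ≤ ‖Y‖ ^ 2 - ‖X‖ ^ 2 := by nlinarith [norm_nonneg X]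
  exact le_of_sq_le_sq (by nlinarith [mul_nonneg h2 h3]) (norm_nonneg _)

theorem norm_moebius_eq {c X Y : ℂ} (h : ‖X‖ = ‖Y‖) :
    ‖X + c * Y‖ = ‖Y + conj c * X‖ := by
  have h1 := norm_sq_moebius c X Y
  rw [h] at h1
  refine (sq_eq_sq₀ (norm_nonneg _) (norm_nonneg _)).1 (by linarith)

theorem norm_moebius_lt {c X Y : ℂ} (hc : ‖c‖ < 1) (h : ‖X‖ < ‖Y‖) :
    ‖X + c * Y‖ < ‖Y + conj c * X‖ := by
  have h1 := norm_sq_moebius c X Y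
  have h2 : 0 < 1 - ‖c‖ ^ 2 := by nlinarith [norm_nonneg c]
  have h3 : 0 < ‖Y‖ ^ 2 - ‖X‖ ^ 2 := by nlinarith [norm_nonneg X]
  exact lt_of_pow_lt_pow_left₀ 2 (norm_nonneg _) (by nlinarith [mul_pos h2 h3])

theorem one_add_mul_ne_zero {c u : ℂ} (hc : ‖c‖ < 1) (hu : ‖u‖ ≤ 1) : 1 + c * u ≠ 0 := by
  intro h
  have h1 : ‖c * u‖ = 1 := by
    rw [show c * u = -1 by linear_combination h]; simp
  rw [norm_mul] at h1
  nlinarith [norm_nonneg c, norm_nonneg u]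

theorem one_sub_mul_ne_zero {c u : ℂ} (hc : ‖c‖ < 1) (hu : ‖u‖ ≤ 1) : 1 - c * u ≠ 0 := by
  have := one_add_mul_ne_zero (c := -c) (u := u) (by simpa using hc) hu
  rwa [neg_mul, ← sub_eq_add_neg] at this

/-- A holomorphic function on the disc that agrees with a quotient `N / D` of polynomials which is
regular on the closed disc, bounded by one there, and unimodular on the circle. -/
def IsRationalInner (g : ℂ → ℂ) : Prop :=
  ∃ N D : ℂ[X], (∀ w ∈ closedBall (0 : ℂ) 1, D.eval w ≠ 0 ∧ ‖N.eval w‖ ≤ ‖D.eval w‖) ∧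
    (∀ w ∈ sphere (0 : ℂ) 1, ‖N.eval w‖ = ‖D.eval w‖) ∧
    ∀ w ∈ ball (0 : ℂ) 1, g w * D.eval w = N.eval w

/-- A self-map of the disc with a zero at `z` is bounded by the Blaschke factor of `z`. -/
theorem norm_mul_le_of_zero {m : ℂ → ℂ} {z : ℂ} (hz : z ∈ ball (0 : ℂ) 1)
    (hm : DifferentiableOn ℂ m (ball 0 1)) (hm1 : ∀ w ∈ ball (0 : ℂ) 1, ‖m w‖ ≤ 1)
    (hmz : m z = 0) {w : ℂ} (hw : w ∈ ball (0 : ℂ) 1) :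
    ‖m w‖ * ‖1 - conj z * w‖ ≤ ‖w - z‖ := by
  have hz1 : ‖z‖ < 1 := by simpa using hz
  have hw1 : ‖w‖ < 1 := by simpa using hw
  have hcz : ‖conj z‖ < 1 := by simpa using hz1
  -- `φ` moves 0 to `z`, so the Schwarz lemma applies to `m ∘ φ`.
  set φ : ℂ → ℂ := fun u => (u + z) / (1 + conj z * u) with hφ
  have hne : ∀ u ∈ ball (0 : ℂ) 1, 1 + conj z * u ≠ 0 := fun u hu =>
    one_add_mul_ne_zero hcz (by simpa using (mem_ball_zero_iff.1 hu).le)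
  have hφm : Set.MapsTo φ (ball 0 1) (ball 0 1) := by
    intro u hu
    rw [mem_ball_zero_iff] at hu ⊢
    rw [hφ]
    simp only [norm_div]
    rw [div_lt_one (norm_pos_iff.2 (hne u (by simpa using hu)))]
    have := norm_moebius_lt (c := z) (X := u) (Y := 1) hz1 (by simpa using hu)
    simpa using this
  have hφd : DifferentiableOn ℂ φ (ball 0 1) := by
    apply DifferentiableOn.div
    · fun_prop
    · fun_prop
    · exact hne
  have hcomp := hm.comp hφd hφm
  have hd : 1 - conj z * w ≠ 0 := one_sub_mul_ne_zero hcz hw1.le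
  set u := (w - z) / (1 - conj z * w) with hu
  have hu1 : ‖u‖ < 1 := by
    rw [hu, norm_div, div_lt_one (norm_pos_iff.2 hd)]
    have := norm_moebius_lt (c := -z) (X := w) (Y := 1) (by simpa using hz1) (by simpa using hw1)
    simpa [sub_eq_add_neg] using this
  have hφu : φ u = w := by
    have h1 := hne u (by simpa using hu1)
    rw [hφ]
    simp only
    rw [div_eq_iff h1]
    have h2 : u * (1 - conj z * w) = w - z := div_mul_cancel₀ _ hd
    linear_combination h2
  have := Complex.norm_le_norm_of_mapsTo_ball hcomp (by
    intro v hv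
    simpa using hm1 _ (hφm hv)) (by simp [hφ, hmz]) hu1
  rw [Function.comp_apply, hφu, hu, norm_div, le_div_iff₀ (norm_pos_iff.2 hd)] at this
  exact this

/-- One step of the Schur algorithm. -/
theorem schur_step {g : ℂ → ℂ} {z : ℂ} (hz : z ∈ ball (0 : ℂ) 1)
    (hg : DifferentiableOn ℂ g (ball 0 1)) (hg1 : ∀ w ∈ ball (0 : ℂ) 1, ‖g w‖ ≤ 1)
    (hgz : ‖g z‖ < 1) :
    ∃ g₁ : ℂ → ℂ, DifferentiableOn ℂ g₁ (ball 0 1) ∧ (∀ w ∈ ball (0 : ℂ) 1, ‖g₁ w‖ ≤ 1) ∧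
      ∀ w ∈ ball (0 : ℂ) 1,
        (g w - g z) * (1 - conj z * w) = (w - z) * g₁ w * (1 - conj (g z) * g w) := by
  set c := g z with hc
  have hcc : ‖conj c‖ < 1 := by simpa using hgz
  have hcz : ‖conj z‖ < 1 := by simpa using hz
  have hne : ∀ w ∈ ball (0 : ℂ) 1, 1 - conj c * g w ≠ 0 := fun w hw =>
    one_sub_mul_ne_zero hcc (hg1 w hw)
  -- A Möbius map after `g` creates a zero at `z`; dividing `m` by the Blaschke factor of `z` yields
  -- `g₁`.
  set m : ℂ → ℂ := fun w => (g w - c) / (1 - conj c * g w) with hm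
  have hmd : DifferentiableOn ℂ m (ball 0 1) := by
    apply DifferentiableOn.div
    · fun_prop
    · fun_prop
    · exact hne
  have hm1 : ∀ w ∈ ball (0 : ℂ) 1, ‖m w‖ ≤ 1 := by
    intro w hw
    rw [hm]
    simp only [norm_div]
    rw [div_le_one (norm_pos_iff.2 (hne w hw))]
    have := norm_moebius_le (c := -c) (X := g w) (Y := 1) (by simpa using hgz.le)
      (by simpa using hg1 w hw)
    simpa [sub_eq_add_neg] using this
  have hmz : m z = 0 := by simp [hm, hc]
  have hds : DifferentiableOn ℂ (dslope m z) (ball 0 1) :=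
    (Complex.differentiableOn_dslope (isOpen_ball.mem_nhds hz)).2 hmd
  have hsl : ∀ w, (w - z) * dslope m z w = m w := by
    intro w
    have := sub_smul_dslope m z w
    rw [smul_eq_mul, hmz, sub_zero] at this
    exact this
  have hg₁d : DifferentiableOn ℂ (fun w => (1 - conj z * w) * dslope m z w) (ball 0 1) := by
    fun_prop
  refine ⟨fun w => (1 - conj z * w) * dslope m z w, hg₁d, ?_, ?_⟩
  · have key : ∀ w ∈ ball (0 : ℂ) 1, w ≠ z → ‖(1 - conj z * w) * dslope m z w‖ ≤ 1 := by
      intro w hw hwz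
      have h1 := norm_mul_le_of_zero hz hmd hm1 hmz hw
      rw [← hsl w, norm_mul] at h1
      have h2 : 0 < ‖w - z‖ := norm_pos_iff.2 (sub_ne_zero.2 hwz)
      rw [norm_mul]
      by_contra hcon
      push Not at hcon
      nlinarith [mul_lt_mul_of_pos_left hcon h2]
    intro w hw
    -- At `z` itself the bound follows by continuity.
    by_cases hwz : w = z
    · subst hwz
      have hcont := (hg₁d.differentiableAt (isOpen_ball.mem_nhds hw)).continuousAt.norm
      refine le_of_tendsto (hcont.tendsto.mono_left (nhdsWithin_le_nhds (s := {w}ᶜ))) ?_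
      filter_upwards [self_mem_nhdsWithin, nhdsWithin_le_nhds (isOpen_ball.mem_nhds hw)] with v h1 h2
      exact key v h2 h1
    · exact key w hw hwz
  · intro w hw
    have h1 := hsl w
    have h2 : m w * (1 - conj c * g w) = g w - c := by
      rw [hm]; exact div_mul_cancel₀ _ (hne w hw)
    simp only
    rw [← h2, ← h1]
    ring

/-- The Möbius image of a smaller closed disc is compact in the open disc. This keeps the bound
strict when a Schur step is undone. -/
theorem norm_lt_of_norm_le_div {c : ℂ} (hc : ‖c‖ < 1) {r : ℝ} (hr : r < 1) :
    ∃ s < 1, ∀ u : ℂ, ‖u‖ ≤ r → ‖(u + c) / (1 + conj c * u)‖ ≤ s := by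
  have hcc : ‖conj c‖ < 1 := by simpa using hc
  by_cases h0 : r < 0
  · exact ⟨0, by norm_num, fun u hu => absurd ((norm_nonneg u).trans hu) (by linarith)⟩
  push Not at h0
  have hcont : ContinuousOn (fun u : ℂ => ‖(u + c) / (1 + conj c * u)‖) (closedBall 0 r) := by
    apply ContinuousOn.norm
    apply ContinuousOn.div
    · fun_prop
    · fun_prop
    · intro u hu
      exact one_add_mul_ne_zero hcc ((mem_closedBall_zero_iff.1 hu).trans hr.le)
  obtain ⟨x, hx, hmax⟩ := (isCompact_closedBall (0 : ℂ) r).exists_isMaxOn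
    ⟨0, by simpa using h0⟩ hcont
  refine ⟨_, ?_, fun u hu => hmax (by simpa using hu)⟩
  have hx1 := (mem_closedBall_zero_iff.1 hx).trans_lt hr
  simp only [norm_div]
  rw [div_lt_one (norm_pos_iff.2 (one_add_mul_ne_zero hcc hx1.le))]
  have := norm_moebius_lt (c := c) (X := x) (Y := 1) hc (by simpa using hx1)
  simpa using this

theorem eq_const_of_norm_max {g : ℂ → ℂ} (hg : DifferentiableOn ℂ g (ball 0 1)) {M : ℝ}
    (hM : ∀ w ∈ ball (0 : ℂ) 1, ‖g w‖ ≤ M) {z : ℂ} (hz : z ∈ ball (0 : ℂ) 1) (hgz : ‖g z‖ = M) :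
    ∀ w ∈ ball (0 : ℂ) 1, g w = g z := by
  have := Complex.eqOn_of_isPreconnected_of_isMaxOn_norm (convex_ball (0 : ℂ) 1).isPreconnected
    isOpen_ball hg hz (fun w hw => by simpa [hgz] using hM w hw)
  intro w hw
  simpa using this hw

/-- **Schur algorithm dichotomy.** A Schur function either is congruent modulo `P` to a function of
norm less than one, or it is rational inner. -/
theorem schur_dichotomy (n : ℕ) : ∀ (P : ℂ[X]) (g : ℂ → ℂ), P ≠ 0 → P.natDegree = n →
    DifferentiableOn ℂ g (ball 0 1) → (∀ w ∈ ball (0 : ℂ) 1, ‖g w‖ ≤ 1) →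
    (∃ (h k : ℂ → ℂ) (r : ℝ), r < 1 ∧ DifferentiableOn ℂ h (ball 0 1) ∧
      DifferentiableOn ℂ k (ball 0 1) ∧
      ∀ w ∈ ball (0 : ℂ) 1, ‖h w‖ ≤ r ∧ g w - h w = P.eval w * k w) ∨ IsRationalInner g := by
  induction n with
  | zero =>
    intro P g hP hn hg hg1
    left
    obtain ⟨c, rfl⟩ := natDegree_eq_zero.1 hn
    have hc : c ≠ 0 := by rintro rfl; simp at hP
    -- Modulo a nonzero constant everything is congruent to 0.
    refine ⟨fun _ => 0, fun w => g w / c, 0, by norm_num, by fun_prop, by fun_prop, ?_⟩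
    intro w hw
    simp
    field_simp
  | succ n ih =>
    intro P g hP hn hg hg1
    obtain ⟨z, hz⟩ := Complex.exists_root (f := P) (by
      rw [degree_eq_natDegree hP, hn]; exact_mod_cast Nat.succ_pos n)
    obtain ⟨P', rfl⟩ := dvd_iff_isRoot.2 hz
    have hP' : P' ≠ 0 := right_ne_zero_of_mul hP
    have hn' : P'.natDegree = n := by
      rw [natDegree_mul (X_sub_C_ne_zero z) hP', natDegree_X_sub_C] at hn
      omega
    by_cases hzb : z ∈ ball (0 : ℂ) 1
    swap
    -- A root outside the open disc gives a unit there and imposes no condition.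
    · rcases ih P' g hP' hn' hg hg1 with ⟨h, k, r, hr, hh, hk, H⟩ | H
      · left
        have hne : ∀ w ∈ ball (0 : ℂ) 1, w - z ≠ 0 := fun w hw h0 =>
          hzb (sub_eq_zero.1 h0 ▸ hw)
        refine ⟨h, fun w => k w / (w - z), r, hr, hh, ?_, fun w hw => ⟨(H w hw).1, ?_⟩⟩
        · exact hk.div (by fun_prop) hne
        · rw [(H w hw).2]
          have := hne w hw
          simp
          field_simp
      · exact Or.inr H
    -- If |g z| = 1, the maximum principle makes `g` a unimodular constant, which is rational inner.
    rcases (hg1 z hzb).lt_or_eq with hlt | heq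
    swap
    · right
      have hcst := eq_const_of_norm_max hg hg1 hzb heq
      refine ⟨C (g z), 1, ?_, ?_, ?_⟩
      · intro w hw
        simp [heq]
      · intro w hw
        simp [heq]
      · intro w hw
        simp [hcst w hw]
    obtain ⟨g₁, hg₁, hg₁1, hrel⟩ := schur_step hzb hg hg1 hlt
    set c := g z with hc
    have hcc : ‖conj c‖ < 1 := by simpa using hlt
    have hz1 : ‖z‖ < 1 := by simpa using hzb
    have hcz : ‖conj z‖ < 1 := by simpa using hzb
    have hzne : ∀ w ∈ closedBall (0 : ℂ) 1, 1 - conj z * w ≠ 0 := fun w hw =>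
      one_sub_mul_ne_zero hcz (by simpa using hw)
    have hble : ∀ w ∈ closedBall (0 : ℂ) 1, ‖w - z‖ ≤ ‖1 - conj z * w‖ := by
      intro w hw
      have := norm_moebius_le (c := -z) (X := w) (Y := 1) (by simpa using hz1.le)
        (by simpa using hw)
      simpa [sub_eq_add_neg] using this
    rcases ih P' g₁ hP' hn' hg₁ hg₁1 with ⟨h₁, k₁, r, hr, hh, hk, H⟩ | ⟨N, D, hD, hN, H⟩
    · left
      obtain ⟨s, hs, hsb⟩ := norm_lt_of_norm_le_div hlt hr
      set β : ℂ → ℂ := fun w => (w - z) / (1 - conj z * w) with hβ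
      have hβd : DifferentiableOn ℂ β (ball 0 1) :=
        DifferentiableOn.div (by fun_prop) (by fun_prop)
          fun w hw => hzne w (ball_subset_closedBall hw)
      have hβ1 : ∀ w ∈ ball (0 : ℂ) 1, ‖β w‖ ≤ 1 := by
        intro w hw
        rw [hβ]
        simp only [norm_div]
        exact div_le_one_of_le₀ (hble w (ball_subset_closedBall hw)) (norm_nonneg _)
      have hβh : ∀ w ∈ ball (0 : ℂ) 1, ‖β w * h₁ w‖ ≤ r := by
        intro w hw
        rw [norm_mul]
        nlinarith [hβ1 w hw, (H w hw).1, norm_nonneg (h₁ w), norm_nonneg (β w)]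
      have hβg : ∀ w ∈ ball (0 : ℂ) 1, ‖β w * g₁ w‖ ≤ 1 := by
        intro w hw
        rw [norm_mul]
        nlinarith [hβ1 w hw, hg₁1 w hw, norm_nonneg (g₁ w), norm_nonneg (β w)]
      have hne1 : ∀ w ∈ ball (0 : ℂ) 1, 1 + conj c * (β w * h₁ w) ≠ 0 := fun w hw =>
        one_add_mul_ne_zero hcc ((hβh w hw).trans hr.le)
      have hne2 : ∀ w ∈ ball (0 : ℂ) 1, 1 + conj c * (β w * g₁ w) ≠ 0 := fun w hw =>
        one_add_mul_ne_zero hcc (hβg w hw)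
      -- The Schur step run backwards from `h₁`. The difference of the Möbius map at β g₁ and at β
      -- h₁ is (1 - |c|²) β P' k₁ over the two denominators, and β supplies the factor w - z missing
      -- from P'.
      refine ⟨fun w => (β w * h₁ w + c) / (1 + conj c * (β w * h₁ w)),
        fun w => (1 - conj c * c) * k₁ w / ((1 - conj z * w) * (1 + conj c * (β w * h₁ w)) *
          (1 + conj c * (β w * g₁ w))), s, hs, ?_, ?_, ?_⟩
      · exact DifferentiableOn.div (by fun_prop) (by fun_prop) hne1
      · refine DifferentiableOn.div (by fun_prop) (by fun_prop) fun w hw => ?_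
        exact mul_ne_zero (mul_ne_zero (hzne w (ball_subset_closedBall hw)) (hne1 w hw)) (hne2 w hw)
      · intro w hw
        refine ⟨hsb _ (hβh w hw), ?_⟩
        have e1 := hne1 w hw
        have e2 := hne2 w hw
        have e3 := hzne w (ball_subset_closedBall hw)
        have hgw : g w = (β w * g₁ w + c) / (1 + conj c * (β w * g₁ w)) := by
          rw [eq_div_iff e2]
          have h1 := hrel w hw
          have h2 : β w * (1 - conj z * w) = w - z := by
            rw [hβ]; exact div_mul_cancel₀ _ e3
          rw [← h2] at h1
          have h3 : (g w - c) = β w * g₁ w * (1 - conj c * g w) := by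
            apply mul_right_cancel₀ e3
            rw [h1]; ring
          linear_combination h3
        have h4 := (H w hw).2
        have hbw : β w = (w - z) / (1 - conj z * w) := rfl
        have h5 : g₁ w = h₁ w + P'.eval w * k₁ w := by linear_combination h4
        rw [hgw]
        simp only [eval_mul, eval_sub, eval_X, eval_C]
        rw [div_sub_div _ _ e2 e1, div_eq_iff (mul_ne_zero e2 e1)]
        have : (w - z) * P'.eval w * ((1 - conj c * c) * k₁ w / ((1 - conj z * w) *
            (1 + conj c * (β w * h₁ w)) * (1 + conj c * (β w * g₁ w)))) *
            ((1 + conj c * (β w * g₁ w)) * (1 + conj c * (β w * h₁ w))) =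
            β w * (P'.eval w * k₁ w) * (1 - conj c * c) := by
          rw [show β w * (P'.eval w * k₁ w) * (1 - conj c * c) =
            (w - z) * (P'.eval w * k₁ w) * (1 - conj c * c) / (1 - conj z * w) by rw [hbw]; ring]
          generalize 1 + conj c * (β w * h₁ w) = A at *
          generalize 1 + conj c * (β w * g₁ w) = B at *
          field_simp
        rw [this, ← h4]
        ring
    · right
      have hle : ∀ w ∈ closedBall (0 : ℂ) 1,
          ‖(w - z) * N.eval w‖ ≤ ‖(1 - conj z * w) * D.eval w‖ := by
        intro w hw
        rw [norm_mul, norm_mul]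
        exact mul_le_mul (hble w hw) (hD w hw).2 (norm_nonneg _) (norm_nonneg _)
      -- The backward Schur step applied to N / D, cleared of fractions.
      refine ⟨(X - C z) * N + C c * ((1 - C (conj z) * X) * D),
        (1 - C (conj z) * X) * D + C (conj c) * ((X - C z) * N), ?_, ?_, ?_⟩
      · intro w hw
        simp only [eval_add, eval_mul, eval_sub, eval_X, eval_C, eval_one]
        refine ⟨?_, norm_moebius_le hlt.le (hle w hw)⟩
        intro h0
        have h1 : ‖(1 - conj z * w) * D.eval w‖ = ‖conj c * ((w - z) * N.eval w)‖ := by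
          rw [eq_neg_of_add_eq_zero_left h0, norm_neg]
        rw [norm_mul (conj c)] at h1
        have h2 : 0 < ‖(1 - conj z * w) * D.eval w‖ :=
          norm_pos_iff.2 (mul_ne_zero (hzne w hw) (hD w hw).1)
        nlinarith [hle w hw, norm_nonneg (conj c)]
      · intro w hw
        simp only [eval_add, eval_mul, eval_sub, eval_X, eval_C, eval_one]
        apply norm_moebius_eq
        rw [norm_mul, norm_mul, hN w hw]
        congr 1
        have := norm_moebius_eq (c := -z) (X := w) (Y := 1) (by simpa using hw)
        simpa [sub_eq_add_neg] using this
      · intro w hw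
        simp only [eval_add, eval_mul, eval_sub, eval_X, eval_C, eval_one]
        have h1 := hrel w hw
        have h2 := H w hw
        linear_combination (D.eval w) * h1 + (w - z) * (1 - conj c * g w) * h2

/-! ### Division of holomorphic functions by a polynomial. -/

/-- Divisibility by a polynomial from a local bound. -/
theorem exists_eq_mul_of_isBigO (n : ℕ) : ∀ (P : ℂ[X]) (φ : ℂ → ℂ), P ≠ 0 → P.natDegree = n →
    DifferentiableOn ℂ φ (ball 0 1) →
    (∀ w ∈ ball (0 : ℂ) 1, φ =O[𝓝 w] fun v => P.eval v) →
    ∃ ψ : ℂ → ℂ, DifferentiableOn ℂ ψ (ball 0 1) ∧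
      ∀ w ∈ ball (0 : ℂ) 1, φ w = P.eval w * ψ w := by
  induction n with
  | zero =>
    intro P φ hP hn hφ _
    obtain ⟨c, rfl⟩ := natDegree_eq_zero.1 hn
    have hc : c ≠ 0 := by rintro rfl; simp at hP
    refine ⟨fun w => φ w / c, by fun_prop, fun w hw => ?_⟩
    simp
    field_simp
  | succ n ih =>
    intro P φ hP hn hφ hO
    obtain ⟨z, hz⟩ := Complex.exists_root (f := P) (by
      rw [degree_eq_natDegree hP, hn]; exact_mod_cast Nat.succ_pos n)
    obtain ⟨P', rfl⟩ := dvd_iff_isRoot.2 hz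
    have hP' : P' ≠ 0 := right_ne_zero_of_mul hP
    have hn' : P'.natDegree = n := by
      rw [natDegree_mul (X_sub_C_ne_zero z) hP', natDegree_X_sub_C] at hn
      omega
    by_cases hzb : z ∈ ball (0 : ℂ) 1
    · have hφz : φ z = 0 := by
        obtain ⟨K, hK⟩ := (hO z hzb).bound
        have := hK.self_of_nhds
        simpa using this
      have hsl : ∀ w, (w - z) * dslope φ z w = φ w := by
        intro w
        have := sub_smul_dslope φ z w
        rw [smul_eq_mul, hφz, sub_zero] at this
        exact this
      have hds : DifferentiableOn ℂ (dslope φ z) (ball 0 1) :=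
        (Complex.differentiableOn_dslope (isOpen_ball.mem_nhds hzb)).2 hφ
      obtain ⟨ψ, hψ, H⟩ := ih P' (dslope φ z) hP' hn' hds (by
        intro w hw
        obtain ⟨K, hK⟩ := (hO w hw).bound
        have hKne : ∀ᶠ v in 𝓝 w, v ≠ z → ‖dslope φ z v‖ ≤ K * ‖P'.eval v‖ := by
          filter_upwards [hK] with v hv hvz
          rw [← hsl v, eval_mul, norm_mul, norm_mul] at hv
          simp only [eval_sub, eval_X, eval_C] at hv
          have : 0 < ‖v - z‖ := norm_pos_iff.2 (sub_ne_zero.2 hvz)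
          by_contra hcon
          push Not at hcon
          nlinarith [mul_lt_mul_of_pos_left hcon this]
        refine Asymptotics.IsBigO.of_bound K ?_
        -- Cancelling |v - z| is possible only for v ≠ z; at `z` the bound is a limit.
        have hpt : ‖dslope φ z w‖ ≤ K * ‖P'.eval w‖ := by
          by_cases hwz : w = z
          · have hc1 := (hds.differentiableAt (isOpen_ball.mem_nhds hw)).continuousAt.norm
            have hc2 : Continuous fun v => K * ‖P'.eval v‖ := by fun_prop
            refine le_of_tendsto_of_tendsto
              (hc1.tendsto.mono_left (nhdsWithin_le_nhds (s := {w}ᶜ)))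
              (hc2.continuousAt.tendsto.mono_left nhdsWithin_le_nhds) ?_
            filter_upwards [self_mem_nhdsWithin, nhdsWithin_le_nhds hKne] with v h1 h2
            exact h2 (by rw [← hwz]; exact h1)
          · exact hKne.self_of_nhds hwz
        by_cases hwz : w = z
        · filter_upwards [hKne] with v hv
          by_cases hvz : v = z
          · rw [hwz] at hpt
            rw [hvz]; exact hpt
          · exact hv hvz
        · filter_upwards [hKne, isOpen_ne.mem_nhds hwz] with v hv hvz
          exact hv hvz)
      refine ⟨ψ, hψ, fun w hw => ?_⟩
      rw [← hsl w, H w hw]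
      simp
      ring
    · have hne : ∀ w ∈ ball (0 : ℂ) 1, w - z ≠ 0 := fun w hw h0 =>
        hzb (sub_eq_zero.1 h0 ▸ hw)
      obtain ⟨ψ, hψ, H⟩ := ih P' φ hP' hn' hφ (by
        intro w hw
        refine (hO w hw).trans ?_
        have h1 : (fun v : ℂ => v - z) =O[𝓝 w] fun _ => (1 : ℂ) :=
          (ContinuousAt.tendsto (by fun_prop : ContinuousAt (fun v : ℂ => v - z) w)).isBigO_one ℂ
        simpa using h1.mul (Asymptotics.isBigO_refl (fun v => P'.eval v) (𝓝 w)))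
      refine ⟨fun w => ψ w / (w - z), hψ.div (by fun_prop) hne, fun w hw => ?_⟩
      have := hne w hw
      rw [H w hw]
      simp
      field_simp

/-! ### The conformal map onto the lens, its boundary values and its inverse. -/

/-- The half-angle of the lens at its corners. -/
def lensAngle (γ : ℝ) : ℝ := Real.arccos (1 / γ)

/-- The exponent in the conformal map onto the lens. -/
def lensExponent (γ : ℝ) : ℝ := 2 * lensAngle γ / Real.pi

/-- The height of the upper corner of the lens. -/
def lensHeight (γ : ℝ) : ℝ := Real.tan (lensAngle γ)

theorem lensAngle_pos {γ : ℝ} (hγ : 1 < γ) : 0 < lensAngle γ :=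
  Real.arccos_pos.2 (by rw [div_lt_one (by linarith)]; exact hγ)

theorem lensAngle_lt {γ : ℝ} (hγ : 1 < γ) : lensAngle γ < Real.pi / 2 :=
  Real.arccos_lt_pi_div_two.2 (by positivity)

theorem cos_lensAngle_pos {γ : ℝ} (hγ : 1 < γ) : 0 < Real.cos (lensAngle γ) :=
  Real.cos_pos_of_mem_Ioo ⟨by linarith [lensAngle_pos hγ, Real.pi_pos], lensAngle_lt hγ⟩

theorem lensHeight_pos {γ : ℝ} (hγ : 1 < γ) : 0 < lensHeight γ :=
  Real.tan_pos_of_pos_of_lt_pi_div_two (lensAngle_pos hγ) (lensAngle_lt hγ)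

theorem lensHeight_mul_cos {γ : ℝ} (hγ : 1 < γ) :
    lensHeight γ * Real.cos (lensAngle γ) = Real.sin (lensAngle γ) :=
  Real.tan_mul_cos (cos_lensAngle_pos hγ).ne'

theorem one_add_lensHeight_sq {γ : ℝ} (hγ : 1 < γ) : 1 + lensHeight γ ^ 2 = γ ^ 2 := by
  have hc : Real.cos (lensAngle γ) = 1 / γ :=
    Real.cos_arccos (by linarith [show (0 : ℝ) < 1 / γ by positivity])
      (by rw [div_le_one (by linarith)]; exact hγ.le)
  have h1 := lensHeight_mul_cos hγ
  have h2 := Real.sin_sq_add_cos_sq (lensAngle γ)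
  rw [← h1, hc] at h2
  have : γ ≠ 0 := by positivity
  field_simp at h2
  linarith

theorem lensExponent_pos {γ : ℝ} (hγ : 1 < γ) : 0 < lensExponent γ :=
  div_pos (by linarith [lensAngle_pos hγ]) Real.pi_pos

theorem lensExponent_mul {γ : ℝ} : lensExponent γ * (Real.pi / 2) = lensAngle γ := by
  unfold lensExponent
  have := Real.pi_pos.ne'
  field_simp

theorem cpow_real_re_im {z : ℂ} (hz : z ≠ 0) (t : ℝ) :
    (z ^ (t : ℂ)).re = Real.exp (Real.log ‖z‖ * t) * Real.cos (z.arg * t) ∧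
    (z ^ (t : ℂ)).im = Real.exp (Real.log ‖z‖ * t) * Real.sin (z.arg * t) := by
  rw [Complex.cpow_def_of_ne_zero hz]
  rw [Complex.exp_re, Complex.exp_im, Complex.re_mul_ofReal, Complex.im_mul_ofReal,
    Complex.log_re, Complex.log_im]
  exact ⟨rfl, rfl⟩

/-- The factor cos α turns tan α into a sine, so the side of a sector edge on which z^t lies is read
off from the sign of sin(α ∓ t arg z). -/
theorem sector_identities {γ : ℝ} (hγ : 1 < γ) {z : ℂ} (hz : z ≠ 0) (t : ℝ) :
    Real.cos (lensAngle γ) * (lensHeight γ * (z ^ (t : ℂ)).re - (z ^ (t : ℂ)).im) =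
      Real.exp (Real.log ‖z‖ * t) * Real.sin (lensAngle γ - z.arg * t) ∧
    Real.cos (lensAngle γ) * (lensHeight γ * (z ^ (t : ℂ)).re + (z ^ (t : ℂ)).im) =
      Real.exp (Real.log ‖z‖ * t) * Real.sin (lensAngle γ + z.arg * t) := by
  obtain ⟨h1, h2⟩ := cpow_real_re_im hz t
  rw [h1, h2, Real.sin_sub, Real.sin_add, ← lensHeight_mul_cos hγ]
  constructor <;> ring

/-- The exponent 2α/π scales arg z from (-π/2, π/2) to (-α, α). -/
theorem cpow_mem_sector {γ : ℝ} (hγ : 1 < γ) {z : ℂ} (hz : 0 < z.re) :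
    |(z ^ (lensExponent γ : ℂ)).im| < lensHeight γ * (z ^ (lensExponent γ : ℂ)).re := by
  have hz0 : z ≠ 0 := by rintro rfl; simp at hz
  obtain ⟨h1, h2⟩ := sector_identities hγ hz0 (lensExponent γ)
  have harg := abs_lt.1 (Complex.abs_arg_lt_pi_div_two_iff.2 (Or.inl hz))
  have ht := lensExponent_pos hγ
  have hm := lensExponent_mul (γ := γ)
  have hl := lensAngle_lt hγ
  have hc := cos_lensAngle_pos hγ
  have e := Real.exp_pos (Real.log ‖z‖ * lensExponent γ)
  have s1 : 0 < Real.sin (lensAngle γ - z.arg * lensExponent γ) :=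
    Real.sin_pos_of_pos_of_lt_pi (by nlinarith) (by nlinarith)
  have s2 : 0 < Real.sin (lensAngle γ + z.arg * lensExponent γ) :=
    Real.sin_pos_of_pos_of_lt_pi (by nlinarith) (by nlinarith)
  have p1 := pos_of_mul_pos_right (h1 ▸ mul_pos e s1) hc.le
  have p2 := pos_of_mul_pos_right (h2 ▸ mul_pos e s2) hc.le
  rw [abs_lt]
  constructor <;> linarith

theorem cpow_mem_sector_boundary {γ : ℝ} (hγ : 1 < γ) {z : ℂ} (hz : z.re = 0) :
    (z ^ (lensExponent γ : ℂ)).im = lensHeight γ * (z ^ (lensExponent γ : ℂ)).re ∨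
    -(z ^ (lensExponent γ : ℂ)).im = lensHeight γ * (z ^ (lensExponent γ : ℂ)).re := by
  have ht := lensExponent_pos hγ
  by_cases hz0 : z = 0
  · left
    rw [hz0, Complex.zero_cpow (by exact_mod_cast ht.ne')]
    simp
  obtain ⟨h1, h2⟩ := sector_identities hγ hz0 (lensExponent γ)
  have hm := lensExponent_mul (γ := γ)
  have hc := cos_lensAngle_pos hγ
  rcases lt_trichotomy z.im 0 with him | him | him
  · right
    have ha : z.arg = -(Real.pi / 2) := Complex.arg_eq_neg_pi_div_two_iff.2 ⟨hz, him⟩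
    rw [show lensAngle γ + z.arg * lensExponent γ = 0 by rw [ha]; linarith, Real.sin_zero,
      mul_zero] at h2
    have := (mul_eq_zero.1 h2).resolve_left hc.ne'
    linarith
  · exact absurd (Complex.ext hz him) hz0
  · left
    have ha : z.arg = Real.pi / 2 := Complex.arg_eq_pi_div_two_iff.2 ⟨hz, him⟩
    rw [show lensAngle γ - z.arg * lensExponent γ = 0 by rw [ha]; linarith, Real.sin_zero,
      mul_zero] at h1
    have := (mul_eq_zero.1 h1).resolve_left hc.ne'
    linarith

theorem cpow_re_pos {γ : ℝ} (hγ : 1 < γ) {z : ℂ} (hz : 0 ≤ z.re) (hz0 : z ≠ 0) :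
    0 < (z ^ (lensExponent γ : ℂ)).re := by
  rw [(cpow_real_re_im hz0 _).1]
  have harg := abs_le.1 (Complex.abs_arg_le_pi_div_two_iff.2 hz)
  have ht := lensExponent_pos hγ
  have hm := lensExponent_mul (γ := γ)
  have hl := lensAngle_lt hγ
  refine mul_pos (Real.exp_pos _) (Real.cos_pos_of_mem_Ioo ⟨by nlinarith, by nlinarith⟩)

theorem cpow_re_nonneg {γ : ℝ} (hγ : 1 < γ) {z : ℂ} (hz : 0 ≤ z.re) :
    0 ≤ (z ^ (lensExponent γ : ℂ)).re := by
  by_cases hz0 : z = 0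
  · rw [hz0, Complex.zero_cpow (by exact_mod_cast (lensExponent_pos hγ).ne')]
    simp
  · exact (cpow_re_pos hγ hz hz0).le

theorem one_add_ne_zero_of_re {y : ℂ} (hy : 0 ≤ y.re) : 1 + y ≠ 0 := by
  intro h
  have := congrArg Complex.re h
  simp at this
  linarith

/-- Relation between the lens and the sector under the Möbius map. -/
theorem lens_sector {γ : ℝ} (hγ : 1 < γ) {s y : ℂ}
    (h : s * (1 + y) = Complex.I * (lensHeight γ : ℂ) * (1 - y)) :
    (γ ^ 2 - ‖1 + s‖ ^ 2) * ‖1 + y‖ ^ 2 =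
        4 * lensHeight γ * (lensHeight γ * y.re - y.im) ∧
      (γ ^ 2 - ‖1 - s‖ ^ 2) * ‖1 + y‖ ^ 2 =
        4 * lensHeight γ * (lensHeight γ * y.re + y.im) := by
  have h1 : ‖1 + s‖ ^ 2 * ‖1 + y‖ ^ 2 =
      ‖(1 + y) + Complex.I * (lensHeight γ : ℂ) * (1 - y)‖ ^ 2 := by
    rw [← mul_pow, ← norm_mul, ← h]; congr 2; ring
  have h2 : ‖1 - s‖ ^ 2 * ‖1 + y‖ ^ 2 =
      ‖(1 + y) - Complex.I * (lensHeight γ : ℂ) * (1 - y)‖ ^ 2 := by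
    rw [← mul_pow, ← norm_mul, ← h]; congr 2; ring
  rw [sub_mul, sub_mul, h1, h2, ← one_add_lensHeight_sq hγ]
  simp only [← Complex.normSq_eq_norm_sq, Complex.normSq_apply, Complex.add_re, Complex.add_im,
    Complex.sub_re, Complex.sub_im, Complex.one_re, Complex.one_im,
    Complex.mul_re, Complex.mul_im, Complex.I_re, Complex.I_im, Complex.ofReal_re,
    Complex.ofReal_im]
  constructor <;> ring

theorem lensMap_apply (γ : ℝ) (w : ℂ) :
    lensMap γ w = Complex.I * (lensHeight γ : ℂ) *
      ((1 - ((1 + Complex.I * w) / (1 - Complex.I * w)) ^ (lensExponent γ : ℂ)) /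
      (1 + ((1 + Complex.I * w) / (1 - Complex.I * w)) ^ (lensExponent γ : ℂ))) := rfl

theorem cayley_re_eq (w : ℂ) :
    ((1 + Complex.I * w) / (1 - Complex.I * w)).re =
      (1 - ‖w‖ ^ 2) / Complex.normSq (1 - Complex.I * w) := by
  rw [Complex.div_re, ← add_div, ← Complex.normSq_eq_norm_sq]
  congr 1
  simp [Complex.normSq_apply]
  ring

theorem one_sub_I_mul_re (w : ℂ) : (1 - Complex.I * w).re = 1 + w.im := by simp

theorem one_add_I_mul_re (w : ℂ) : (1 + Complex.I * w).re = 1 - w.im := by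
  simp [sub_eq_add_neg]

theorem one_sub_I_mul_re_pos {w : ℂ} (hw : w ∈ ball (0 : ℂ) 1) : 0 < (1 - Complex.I * w).re := by
  rw [one_sub_I_mul_re]
  have := abs_lt.1 ((Complex.abs_im_le_norm w).trans_lt (mem_ball_zero_iff.1 hw))
  linarith

theorem one_sub_I_mul_ne_zero {w : ℂ} (hw : w ∈ ball (0 : ℂ) 1) : 1 - Complex.I * w ≠ 0 := by
  intro h
  have := one_sub_I_mul_re_pos hw
  rw [h] at this
  simp at this

theorem cayley_re_pos {w : ℂ} (hw : w ∈ ball (0 : ℂ) 1) :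
    0 < ((1 + Complex.I * w) / (1 - Complex.I * w)).re := by
  rw [cayley_re_eq]
  refine div_pos ?_ (Complex.normSq_pos.2 (one_sub_I_mul_ne_zero hw))
  have := mem_ball_zero_iff.1 hw
  nlinarith [norm_nonneg w]

theorem differentiableOn_lensMap {γ : ℝ} (hγ : 1 < γ) :
    DifferentiableOn ℂ (lensMap γ) (ball 0 1) := by
  have h1 : DifferentiableOn ℂ (fun w : ℂ => (1 + Complex.I * w) / (1 - Complex.I * w))
      (ball 0 1) :=
    DifferentiableOn.div (by fun_prop) (by fun_prop) fun w hw => one_sub_I_mul_ne_zero hw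
  have h2 : DifferentiableOn ℂ (fun w : ℂ => ((1 + Complex.I * w) / (1 - Complex.I * w)) ^
      (lensExponent γ : ℂ)) (ball 0 1) :=
    h1.cpow (by fun_prop) fun w hw => Complex.mem_slitPlane_iff.2 (Or.inl (cayley_re_pos hw))
  have h3 := ((h2.const_sub 1).div (h2.const_add 1) fun w hw =>
    one_add_ne_zero_of_re (cpow_re_nonneg hγ (cayley_re_pos hw).le)).const_mul
      (Complex.I * (lensHeight γ : ℂ))
  exact h3

theorem lensMap_mul {γ : ℝ} (hγ : 1 < γ) {w : ℂ}
    (hw : 0 ≤ ((1 + Complex.I * w) / (1 - Complex.I * w)).re) :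
    lensMap γ w * (1 + ((1 + Complex.I * w) / (1 - Complex.I * w)) ^ (lensExponent γ : ℂ)) =
      Complex.I * (lensHeight γ : ℂ) *
        (1 - ((1 + Complex.I * w) / (1 - Complex.I * w)) ^ (lensExponent γ : ℂ)) := by
  rw [lensMap_apply, mul_assoc, div_mul_cancel₀ _ (one_add_ne_zero_of_re (cpow_re_nonneg hγ hw))]

/-- The open lens. -/
def lens (γ : ℝ) : Set ℂ := {s | ‖1 + s‖ < γ ∧ ‖1 - s‖ < γ}

theorem lensMap_mem_lens {γ : ℝ} (hγ : 1 < γ) {w : ℂ} (hw : w ∈ ball (0 : ℂ) 1) :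
    lensMap γ w ∈ lens γ := by
  have hre := cayley_re_pos hw
  obtain ⟨h1, h2⟩ := lens_sector hγ (lensMap_mul hγ hre.le)
  have hs := abs_lt.1 (cpow_mem_sector hγ hre)
  have hT := lensHeight_pos hγ
  have hy : 0 < ‖1 + ((1 + Complex.I * w) / (1 - Complex.I * w)) ^ (lensExponent γ : ℂ)‖ ^ 2 :=
    pow_pos (norm_pos_iff.2 (one_add_ne_zero_of_re (cpow_re_nonneg hγ hre.le))) 2
  constructor
  · have := pos_of_mul_pos_left (h1 ▸ mul_pos (mul_pos four_pos hT) (by linarith [hs.1, hs.2])) hy.le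
    exact lt_of_pow_lt_pow_left₀ 2 (by linarith) (by linarith)
  · have := pos_of_mul_pos_left (h2 ▸ mul_pos (mul_pos four_pos hT) (by linarith [hs.1, hs.2])) hy.le
    exact lt_of_pow_lt_pow_left₀ 2 (by linarith) (by linarith)

/-- At w = -i the quotient is 2 / 0 = 0, so `lensMap` takes the value of the opposite corner. The
claim survives, but continuity fails there, which is why `lensExt` is introduced. -/
theorem lensMap_sphere {γ : ℝ} (hγ : 1 < γ) {w : ℂ} (hw : w ∈ sphere (0 : ℂ) 1) :
    ‖1 + lensMap γ w‖ = γ ∨ ‖1 - lensMap γ w‖ = γ := by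
  have hre : ((1 + Complex.I * w) / (1 - Complex.I * w)).re = 0 := by
    rw [cayley_re_eq, mem_sphere_zero_iff_norm.1 hw]; simp
  obtain ⟨h1, h2⟩ := lens_sector hγ (lensMap_mul hγ hre.ge)
  have hy : ‖1 + ((1 + Complex.I * w) / (1 - Complex.I * w)) ^ (lensExponent γ : ℂ)‖ ^ 2 ≠ 0 :=
    pow_ne_zero 2 (norm_ne_zero_iff.2 (one_add_ne_zero_of_re (cpow_re_nonneg hγ hre.ge)))
  rcases cpow_mem_sector_boundary hγ hre with h | h
  · left
    rw [h, sub_self, mul_zero] at h1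
    have := (mul_eq_zero.1 h1).resolve_right hy
    exact (sq_eq_sq₀ (norm_nonneg _) (by linarith)).1 (by linarith)
  · right
    rw [← h, neg_add_cancel, mul_zero] at h2
    have := (mul_eq_zero.1 h2).resolve_right hy
    exact (sq_eq_sq₀ (norm_nonneg _) (by linarith)).1 (by linarith)

/-- The arguments add up to less than π in absolute value, so no branch is crossed. -/
theorem mul_cpow_of_re {X z : ℂ} (hX : 0 < X.re) (hz : 0 ≤ z.re) {t : ℝ} (ht : 0 < t) :
    (X * z) ^ (t : ℂ) = X ^ (t : ℂ) * z ^ (t : ℂ) := by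
  have hX0 : X ≠ 0 := by rintro rfl; simp at hX
  by_cases hz0 : z = 0
  · rw [hz0, mul_zero, Complex.zero_cpow (by exact_mod_cast ht.ne'), mul_zero]
  have h1 := abs_lt.1 (Complex.abs_arg_lt_pi_div_two_iff.2 (Or.inl hX))
  have h2 := abs_le.1 (Complex.abs_arg_le_pi_div_two_iff.2 hz)
  have hl : Complex.log (X * z) = Complex.log X + Complex.log z :=
    (Complex.log_mul_eq_add_log_iff hX0 hz0).2 ⟨by linarith, by linarith⟩
  rw [Complex.cpow_def_of_ne_zero (mul_ne_zero hX0 hz0), Complex.cpow_def_of_ne_zero hX0,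
    Complex.cpow_def_of_ne_zero hz0, hl, ← Complex.exp_add]
  congr 1
  ring

/-- The continuous extension of `lensMap γ` to the closed disc. -/
def lensExt (γ : ℝ) (w : ℂ) : ℂ :=
  Complex.I * (lensHeight γ : ℂ) *
    (((1 - Complex.I * w) ^ (lensExponent γ : ℂ) - (1 + Complex.I * w) ^ (lensExponent γ : ℂ)) /
    ((1 - Complex.I * w) ^ (lensExponent γ : ℂ) + (1 + Complex.I * w) ^ (lensExponent γ : ℂ)))

theorem re_nonneg_of_closedBall {w : ℂ} (hw : w ∈ closedBall (0 : ℂ) 1) :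
    0 ≤ (1 - Complex.I * w).re ∧ 0 ≤ (1 + Complex.I * w).re := by
  rw [one_sub_I_mul_re, one_add_I_mul_re]
  have := abs_le.1 ((Complex.abs_im_le_norm w).trans (mem_closedBall_zero_iff.1 hw))
  constructor <;> linarith

theorem continuousOn_lensExt {γ : ℝ} (hγ : 1 < γ) : ContinuousOn (lensExt γ) (closedBall 0 1) := by
  have ht := lensExponent_pos hγ
  have h1 : ContinuousOn (fun w : ℂ => (1 - Complex.I * w) ^ (lensExponent γ : ℂ))
      (closedBall 0 1) := fun w hw =>
    ((Complex.continuousAt_cpow_const_of_re_pos (Or.inl (re_nonneg_of_closedBall hw).1)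
      (by simpa using ht)).comp (f := fun w : ℂ => 1 - Complex.I * w)
        (by fun_prop)).continuousWithinAt
  have h2 : ContinuousOn (fun w : ℂ => (1 + Complex.I * w) ^ (lensExponent γ : ℂ))
      (closedBall 0 1) := fun w hw =>
    ((Complex.continuousAt_cpow_const_of_re_pos (Or.inl (re_nonneg_of_closedBall hw).2)
      (by simpa using ht)).comp (f := fun w : ℂ => 1 + Complex.I * w)
        (by fun_prop)).continuousWithinAt
  refine continuousOn_const.mul ((h1.sub h2).div (h1.add h2) fun w hw h0 => ?_)
  obtain ⟨r1, r2⟩ := re_nonneg_of_closedBall hw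
  have hre := congrArg Complex.re h0
  rw [Complex.add_re, Complex.zero_re] at hre
  by_cases hX : 1 - Complex.I * w = 0
  · have hY : 1 + Complex.I * w ≠ 0 := fun h => by
      have : (2 : ℂ) = 0 := by linear_combination hX + h
      norm_num at this
    have := cpow_re_pos hγ r2 hY
    have := cpow_re_nonneg hγ r1
    linarith
  · have := cpow_re_pos hγ r1 hX
    have := cpow_re_nonneg hγ r2
    linarith

/-- Numerator and denominator of `lensMap` are multiplied by (1 - iw)^t, which removes the pole of
the Cayley transform. -/
theorem lensExt_eq_lensMap {γ : ℝ} (hγ : 1 < γ) {w : ℂ} (hw : w ∈ closedBall (0 : ℂ) 1)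
    (hX : 1 - Complex.I * w ≠ 0) : lensExt γ w = lensMap γ w := by
  have hXre : 0 < (1 - Complex.I * w).re := by
    refine (re_nonneg_of_closedBall hw).1.lt_of_ne' fun h => hX (Complex.ext h ?_)
    rw [one_sub_I_mul_re] at h
    have h1 := mem_closedBall_zero_iff.1 hw
    have h2 := Complex.sq_norm w
    rw [Complex.normSq_apply] at h2
    have h3 : w.im = -1 := by linarith
    rw [h3] at h2
    have h4 : w.re = 0 := by nlinarith [norm_nonneg w]
    simp [h4]
  have hz : 0 ≤ ((1 + Complex.I * w) / (1 - Complex.I * w)).re := by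
    rw [cayley_re_eq]
    have h1 := mem_closedBall_zero_iff.1 hw
    exact div_nonneg (by nlinarith [norm_nonneg w]) (Complex.normSq_nonneg _)
  have hY := mul_cpow_of_re hXre hz (lensExponent_pos hγ)
  rw [mul_div_cancel₀ _ hX] at hY
  have hX0 : (1 - Complex.I * w) ^ (lensExponent γ : ℂ) ≠ 0 := fun h =>
    (cpow_re_pos hγ hXre.le hX).ne' (by rw [h]; rfl)
  rw [lensExt, lensMap_apply, hY]
  congr 1
  rw [← mul_one_sub, ← mul_one_add, mul_div_mul_left _ _ hX0]

theorem lensExt_eq_of_mem_ball {γ : ℝ} (hγ : 1 < γ) {w : ℂ} (hw : w ∈ ball (0 : ℂ) 1) :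
    lensExt γ w = lensMap γ w :=
  lensExt_eq_lensMap hγ (ball_subset_closedBall hw) (one_sub_I_mul_ne_zero hw)

theorem lensExt_sphere {γ : ℝ} (hγ : 1 < γ) {w : ℂ} (hw : w ∈ sphere (0 : ℂ) 1) :
    ‖1 + lensExt γ w‖ = γ ∨ ‖1 - lensExt γ w‖ = γ := by
  by_cases hX : 1 - Complex.I * w = 0
  · left
    have hY : 1 + Complex.I * w = 2 := by linear_combination -hX
    have ht : (lensExponent γ : ℂ) ≠ 0 := by exact_mod_cast (lensExponent_pos hγ).ne'
    have h2 : (2 : ℂ) ^ (lensExponent γ : ℂ) ≠ 0 := by simp [Complex.cpow_eq_zero_iff]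
    have : lensExt γ w = -(Complex.I * (lensHeight γ : ℂ)) := by
      rw [lensExt, hX, hY, Complex.zero_cpow ht, zero_sub, zero_add, neg_div, div_self h2]
      ring
    rw [this]
    refine (sq_eq_sq₀ (norm_nonneg _) (by linarith)).1 ?_
    rw [← one_add_lensHeight_sq hγ, ← Complex.normSq_eq_norm_sq, Complex.normSq_apply]
    simp
    ring
  · rw [lensExt_eq_lensMap hγ (sphere_subset_closedBall hw) hX]
    exact lensMap_sphere hγ hw

/-- The Möbius map from the lens onto the sector. -/
def lensToSector (γ : ℝ) (s : ℂ) : ℂ :=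
  (Complex.I * (lensHeight γ : ℂ) - s) / (Complex.I * (lensHeight γ : ℂ) + s)

/-- The inverse of `lensMap γ`. -/
def lensInv (γ : ℝ) (s : ℂ) : ℂ :=
  -Complex.I * ((lensToSector γ s ^ ((lensExponent γ)⁻¹ : ℂ) - 1) /
    (lensToSector γ s ^ ((lensExponent γ)⁻¹ : ℂ) + 1))

theorem corner_add_ne_zero {γ : ℝ} (hγ : 1 < γ) {s : ℂ} (hs : s ∈ lens γ) :
    Complex.I * (lensHeight γ : ℂ) + s ≠ 0 := by
  intro h
  have h1 := hs.1
  rw [show s = -(Complex.I * (lensHeight γ : ℂ)) by linear_combination h] at h1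
  have h2 := one_add_lensHeight_sq hγ
  have h3 : ‖1 + -(Complex.I * (lensHeight γ : ℂ))‖ ^ 2 = γ ^ 2 := by
    rw [← h2, ← Complex.normSq_eq_norm_sq, Complex.normSq_apply]
    simp
    ring
  nlinarith [norm_nonneg (1 + -(Complex.I * (lensHeight γ : ℂ)))]

theorem lensToSector_spec {γ : ℝ} (hγ : 1 < γ) {s : ℂ} (hs : s ∈ lens γ) :
    1 + lensToSector γ s ≠ 0 ∧ s * (1 + lensToSector γ s) =
      Complex.I * (lensHeight γ : ℂ) * (1 - lensToSector γ s) := by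
  have h := corner_add_ne_zero hγ hs
  have hT : (lensHeight γ : ℂ) ≠ 0 := by exact_mod_cast (lensHeight_pos hγ).ne'
  have h1 : lensToSector γ s * (Complex.I * (lensHeight γ : ℂ) + s) =
    Complex.I * (lensHeight γ : ℂ) - s := div_mul_cancel₀ _ h
  constructor
  · intro h0
    have : 2 * (Complex.I * (lensHeight γ : ℂ)) = 0 := by
      linear_combination h1.symm + (Complex.I * (lensHeight γ : ℂ) + s) * h0
    simp [hT] at this
  · linear_combination h1

/-- The strict lens inequalities make sin(α ± arg y) positive, and |arg y| < π/2 then leaves only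
|arg y| < α. -/
theorem lensToSector_re_arg {γ : ℝ} (hγ : 1 < γ) {s : ℂ} (hs : s ∈ lens γ) :
    0 < (lensToSector γ s).re ∧ |(lensToSector γ s).arg| < lensAngle γ := by
  obtain ⟨hne, hrel⟩ := lensToSector_spec hγ hs
  obtain ⟨h1, h2⟩ := lens_sector hγ hrel
  set y := lensToSector γ s with hy
  have hyp : 0 < ‖1 + y‖ ^ 2 := pow_pos (norm_pos_iff.2 hne) 2
  have hT := lensHeight_pos hγ
  have hs1 : 0 < γ ^ 2 - ‖1 + s‖ ^ 2 := by nlinarith [hs.1, norm_nonneg (1 + s)]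
  have hs2 : 0 < γ ^ 2 - ‖1 - s‖ ^ 2 := by nlinarith [hs.2, norm_nonneg (1 - s)]
  have q1 : 0 < lensHeight γ * y.re - y.im :=
    pos_of_mul_pos_right (h1 ▸ mul_pos hs1 hyp) (by positivity)
  have q2 : 0 < lensHeight γ * y.re + y.im :=
    pos_of_mul_pos_right (h2 ▸ mul_pos hs2 hyp) (by positivity)
  have hre : 0 < y.re := pos_of_mul_pos_right (by linarith : 0 < lensHeight γ * y.re) hT.le
  refine ⟨hre, ?_⟩
  have hy0 : y ≠ 0 := by intro h; rw [h] at hre; simp at hre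
  have hid := sector_identities hγ hy0 1
  simp only [Complex.ofReal_one, Complex.cpow_one, mul_one] at hid
  have hc := cos_lensAngle_pos hγ
  have e := Real.exp_pos (Real.log ‖y‖)
  have s1 : 0 < Real.sin (lensAngle γ - y.arg) :=
    pos_of_mul_pos_right (hid.1 ▸ mul_pos hc q1) e.le
  have s2 : 0 < Real.sin (lensAngle γ + y.arg) :=
    pos_of_mul_pos_right (hid.2 ▸ mul_pos hc q2) e.le
  have harg := abs_lt.1 (Complex.abs_arg_lt_pi_div_two_iff.2 (Or.inl hre))
  have ha := lensAngle_pos hγ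
  have hb := lensAngle_lt hγ
  rw [abs_lt]
  constructor
  · by_contra hcon
    push Not at hcon
    have := Real.sin_nonpos_of_nonpos_of_neg_pi_le (x := lensAngle γ + y.arg) (by linarith)
      (by linarith [Real.pi_pos])
    linarith
  · by_contra hcon
    push Not at hcon
    have := Real.sin_nonpos_of_nonpos_of_neg_pi_le (x := lensAngle γ - y.arg) (by linarith)
      (by linarith [Real.pi_pos])
    linarith

theorem lensToSector_cpow {γ : ℝ} (hγ : 1 < γ) {s : ℂ} (hs : s ∈ lens γ) :
    0 < (lensToSector γ s ^ ((lensExponent γ)⁻¹ : ℂ)).re ∧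
      (lensToSector γ s ^ ((lensExponent γ)⁻¹ : ℂ)) ^ (lensExponent γ : ℂ) =
        lensToSector γ s := by
  obtain ⟨hre, harg⟩ := lensToSector_re_arg hγ hs
  set y := lensToSector γ s
  have hy0 : y ≠ 0 := by intro h; rw [h] at hre; simp at hre
  have ht := lensExponent_pos hγ
  have hm := lensExponent_mul (γ := γ)
  have harg2 : |y.arg * (lensExponent γ)⁻¹| < Real.pi / 2 := by
    rw [abs_mul, abs_of_pos (inv_pos.2 ht), ← div_eq_mul_inv, div_lt_iff₀ ht]
    linarith
  have hab := abs_lt.1 harg2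
  constructor
  · rw [← Complex.ofReal_inv, (cpow_real_re_im hy0 _).1]
    exact mul_pos (Real.exp_pos _) (Real.cos_pos_of_mem_Ioo ⟨by linarith, by linarith⟩)
  · have him : (Complex.log y * ((lensExponent γ)⁻¹ : ℂ)).im = y.arg * (lensExponent γ)⁻¹ := by
      rw [← Complex.ofReal_inv, Complex.im_mul_ofReal, Complex.log_im]
    rw [← Complex.cpow_mul _ (by rw [him]; linarith [Real.pi_pos])
      (by rw [him]; linarith [Real.pi_pos]),
      inv_mul_cancel₀ (by exact_mod_cast ht.ne'), Complex.cpow_one]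

theorem add_one_ne_zero_of_re {z : ℂ} (hz : 0 < z.re) : z + 1 ≠ 0 := by
  rw [add_comm]; exact one_add_ne_zero_of_re hz.le

theorem lensInv_mem_ball {γ : ℝ} (hγ : 1 < γ) {s : ℂ} (hs : s ∈ lens γ) :
    lensInv γ s ∈ ball (0 : ℂ) 1 := by
  have hz := (lensToSector_cpow hγ hs).1
  rw [mem_ball_zero_iff, lensInv]
  set z := lensToSector γ s ^ ((lensExponent γ)⁻¹ : ℂ)
  rw [norm_mul, norm_neg, Complex.norm_I, one_mul, norm_div,
    div_lt_one (norm_pos_iff.2 (add_one_ne_zero_of_re hz))]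
  refine lt_of_pow_lt_pow_left₀ 2 (norm_nonneg _) ?_
  simp only [← Complex.normSq_eq_norm_sq, Complex.normSq_apply, Complex.sub_re, Complex.sub_im,
    Complex.add_re, Complex.add_im, Complex.one_re, Complex.one_im]
  nlinarith

theorem lensMap_lensInv {γ : ℝ} (hγ : 1 < γ) {s : ℂ} (hs : s ∈ lens γ) :
    lensMap γ (lensInv γ s) = s := by
  obtain ⟨hz, hzt⟩ := lensToSector_cpow hγ hs
  obtain ⟨hne, hrel⟩ := lensToSector_spec hγ hs
  have hc : (1 + Complex.I * lensInv γ s) / (1 - Complex.I * lensInv γ s) =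
      lensToSector γ s ^ ((lensExponent γ)⁻¹ : ℂ) := by
    rw [lensInv]
    set z := lensToSector γ s ^ ((lensExponent γ)⁻¹ : ℂ)
    have h1 := add_one_ne_zero_of_re hz
    have h2 : Complex.I * (-Complex.I * ((z - 1) / (z + 1))) = (z - 1) / (z + 1) := by
      rw [← mul_assoc, mul_neg, Complex.I_mul_I]; ring
    rw [h2, div_eq_iff]
    · field_simp
      ring
    · intro h0
      field_simp at h0
      ring_nf at h0
      norm_num at h0
  rw [lensMap_apply, hc, hzt, ← mul_div_assoc, div_eq_iff hne, hrel]

theorem differentiableOn_lensInv {γ : ℝ} (hγ : 1 < γ) :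
    DifferentiableOn ℂ (lensInv γ) (lens γ) := by
  have h1 : DifferentiableOn ℂ (lensToSector γ) (lens γ) :=
    DifferentiableOn.div (by fun_prop) (by fun_prop) fun s hs => corner_add_ne_zero hγ hs
  have h2 : DifferentiableOn ℂ (fun s => lensToSector γ s ^ ((lensExponent γ)⁻¹ : ℂ)) (lens γ) :=
    h1.cpow (by fun_prop) fun s hs =>
      Complex.mem_slitPlane_iff.2 (Or.inl (lensToSector_re_arg hγ hs).1)
  exact ((h2.sub_const 1).div (h2.add_const 1) fun s hs =>
    add_one_ne_zero_of_re (lensToSector_cpow hγ hs).1).const_mul (-Complex.I)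

/-- Conjugating s replaces y by the inverse of its conjugate; principal powers respect this, and so
does the final Möbius map. -/
theorem lensInv_conj {γ : ℝ} (hγ : 1 < γ) {s : ℂ} (hs : s ∈ lens γ) :
    lensInv γ (conj s) = conj (lensInv γ s) := by
  obtain ⟨hre, -⟩ := lensToSector_re_arg hγ hs
  have hz := (lensToSector_cpow hγ hs).1
  have hy : lensToSector γ (conj s) = (conj (lensToSector γ s))⁻¹ := by
    rw [lensToSector, lensToSector, map_div₀, inv_div, map_sub, map_add, map_mul,
      Complex.conj_I, Complex.conj_ofReal, ← neg_div_neg_eq]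
    congr 1 <;> ring
  have hargy : (lensToSector γ s).arg ≠ Real.pi := by
    have := abs_lt.1 (Complex.abs_arg_lt_pi_div_two_iff.2 (Or.inl hre))
    linarith [Real.pi_pos]
  have hargy' : (conj (lensToSector γ s)).arg ≠ Real.pi := by
    have := abs_lt.1 (Complex.abs_arg_lt_pi_div_two_iff.2
      (Or.inl (by simpa using hre : 0 < (conj (lensToSector γ s)).re)))
    linarith [Real.pi_pos]
  have hz' : lensToSector γ (conj s) ^ ((lensExponent γ)⁻¹ : ℂ) =
      (conj (lensToSector γ s ^ ((lensExponent γ)⁻¹ : ℂ)))⁻¹ := by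
    rw [hy, Complex.inv_cpow _ _ hargy', Complex.conj_cpow _ _ hargy, map_inv₀,
      Complex.conj_ofReal]
  rw [lensInv, lensInv, hz']
  set z := lensToSector γ s ^ ((lensExponent γ)⁻¹ : ℂ)
  have hz0 : conj z ≠ 0 := by
    rw [_root_.map_ne_zero]; intro h; rw [h] at hz; simp at hz
  have hz1 : conj z + 1 ≠ 0 := add_one_ne_zero_of_re (by simpa using hz)
  have hz2 : 1 + conj z ≠ 0 := by rwa [add_comm]
  rw [map_mul, map_neg, Complex.conj_I, map_div₀, map_sub, map_add, map_one]
  field_simp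
  ring

/-! ### Bounds near the circle and normal families. -/

/-- A bound on the circle propagates to an annulus. -/
theorem exists_radius_lt_of_sphere {m : ℂ → ℝ} (hm : ContinuousOn m (closedBall 0 1)) {c : ℝ}
    (hc : ∀ w ∈ sphere (0 : ℂ) 1, c < m w) :
    ∃ ρ, 0 < ρ ∧ ρ < 1 ∧ ∀ w ∈ closedBall (0 : ℂ) 1, ρ ≤ ‖w‖ → c < m w := by
  have hK : IsCompact (closedBall (0 : ℂ) 1 ∩ m ⁻¹' Set.Iic c) :=
    (isCompact_closedBall _ _).of_isClosed_subset
      (hm.preimage_isClosed_of_isClosed isClosed_closedBall isClosed_Iic) Set.inter_subset_left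
  rcases (closedBall (0 : ℂ) 1 ∩ m ⁻¹' Set.Iic c).eq_empty_or_nonempty with he | hne
  · refine ⟨1 / 2, by norm_num, by norm_num, fun w hw _ => ?_⟩
    by_contra hcon
    exact Set.notMem_empty w (he ▸ ⟨hw, not_lt.1 hcon⟩)
  · obtain ⟨x, hx, hmax⟩ := hK.exists_isMaxOn hne continuous_norm.continuousOn
    have hx1 : ‖x‖ < 1 := by
      refine (mem_closedBall_zero_iff.1 hx.1).lt_of_ne fun h => ?_
      exact (hc x (mem_sphere_zero_iff_norm.2 h)).not_ge hx.2
    refine ⟨(1 + ‖x‖) / 2, by positivity, by linarith, fun w hw hρ => ?_⟩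
    by_contra hcon
    have : ‖w‖ ≤ ‖x‖ := hmax (show w ∈ closedBall (0 : ℂ) 1 ∩ m ⁻¹' Set.Iic c from
      ⟨hw, not_lt.1 hcon⟩)
    linarith

theorem norm_le_of_annulus {d : ℂ → ℂ} (hd : DifferentiableOn ℂ d (ball 0 1)) {ρ C : ℝ}
    (hρ0 : 0 < ρ) (hρ : ρ < 1) (h : ∀ w ∈ ball (0 : ℂ) 1, ρ ≤ ‖w‖ → ‖d w‖ ≤ C) :
    ∀ w ∈ ball (0 : ℂ) 1, ‖d w‖ ≤ C := by
  intro w hw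
  by_cases hwρ : ρ ≤ ‖w‖
  · exact h w hw hwρ
  push Not at hwρ
  refine Complex.norm_le_of_forall_mem_frontier_norm_le (U := ball 0 ρ) isBounded_ball ?_ ?_
    (subset_closure (by simpa using hwρ))
  · exact (hd.mono (closedBall_subset_ball hρ)).diffContOnCl_ball subset_rfl
  · intro z hz
    rw [frontier_ball _ hρ0.ne', mem_sphere_zero_iff_norm] at hz
    exact h z (by simpa [hz] using hρ) hz.ge

/-- Near the circle |b| is bounded below, so a bound on a + b q bounds q there; the maximum
principle carries it across the zeros of b. That `M` does not depend on `q` is what compactness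
needs. -/
theorem exists_uniform_bound {a b : ℂ → ℂ} (ha : ∃ C : ℝ, ∀ w ∈ ball (0 : ℂ) 1, ‖a w‖ ≤ C)
    (hb : ContinuousOn b (closedBall 0 1)) (hbT : ∀ w ∈ sphere (0 : ℂ) 1, b w ≠ 0) (c : ℝ) :
    ∃ M : ℝ, ∀ q : ℂ → ℂ, DifferentiableOn ℂ q (ball 0 1) →
      (∀ w ∈ ball (0 : ℂ) 1, ‖a w + b w * q w‖ ≤ c) → ∀ w ∈ ball (0 : ℂ) 1, ‖q w‖ ≤ M := by
  obtain ⟨C, hC⟩ := ha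
  obtain ⟨x, hx, hmin⟩ := (isCompact_sphere (0 : ℂ) 1).exists_isMinOn
    (NormedSpace.sphere_nonempty.2 zero_le_one) (hb.norm.mono sphere_subset_closedBall)
  have hpos : 0 < ‖b x‖ := norm_pos_iff.2 (hbT x hx)
  obtain ⟨ρ, hρ0, hρ1, hρ⟩ := exists_radius_lt_of_sphere (c := ‖b x‖ / 2) hb.norm (by
    intro w hw
    have : ‖b x‖ ≤ ‖b w‖ := hmin hw
    linarith)
  refine ⟨(c + C) / (‖b x‖ / 2), fun q hq hqc => norm_le_of_annulus hq hρ0 hρ1 fun w hw hw1 => ?_⟩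
  have h1 := hρ w (ball_subset_closedBall hw) hw1
  have h2 : ‖b w * q w‖ ≤ c + C := by
    calc ‖b w * q w‖ = ‖(a w + b w * q w) - a w‖ := by congr 1; ring
      _ ≤ _ := (norm_sub_le _ _).trans (add_le_add (hqc w hw) (hC w hw))
  rw [norm_mul] at h2
  rw [le_div_iff₀ (by positivity)]
  nlinarith [norm_nonneg (q w)]

theorem norm_taylor_coeff_le {q : ℂ → ℂ} (hq : DifferentiableOn ℂ q (ball 0 1)) {M : ℝ}
    (hM : ∀ w ∈ ball (0 : ℂ) 1, ‖q w‖ ≤ M) (k : ℕ) :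
    ‖((k.factorial : ℂ))⁻¹ * iteratedDeriv k q 0‖ ≤ M := by
  have hr : ∀ r ∈ Set.Ioo (0 : ℝ) 1,
      ‖((k.factorial : ℂ))⁻¹ * iteratedDeriv k q 0‖ ≤ M / r ^ k := by
    intro r hr
    have h1 := Complex.norm_iteratedDeriv_le_of_forall_mem_sphere_norm_le k (f := q) (c := 0)
      (R := r) (C := M) hr.1
      ((hq.mono (closedBall_subset_ball hr.2)).diffContOnCl_ball subset_rfl) (by
        intro z hz
        exact hM z (by simpa [mem_sphere_zero_iff_norm.1 hz] using hr.2))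
    rw [norm_mul, norm_inv, Complex.norm_natCast]
    have h2 : (0 : ℝ) < k.factorial := by exact_mod_cast k.factorial_pos
    rw [inv_mul_le_iff₀ h2]
    calc _ ≤ _ := h1
      _ = _ := by ring
  have ht : Tendsto (fun r : ℝ => M / r ^ k) (𝓝[<] 1) (𝓝 (M / 1 ^ k)) :=
    (ContinuousAt.tendsto (f := fun r : ℝ => M / r ^ k)
      (by fun_prop (disch := simp))).mono_left nhdsWithin_le_nhds
  rw [one_pow, div_one] at ht
  exact ge_of_tendsto ht (by
    filter_upwards [Ioo_mem_nhdsLT zero_lt_one] with r h using hr r h)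

/-- **Montel's theorem** on the disc, for pointwise convergence. -/
theorem exists_subseq_tendsto_of_bounded {q : ℕ → ℂ → ℂ}
    (hq : ∀ n, DifferentiableOn ℂ (q n) (ball 0 1)) {M : ℝ}
    (hM : ∀ n, ∀ w ∈ ball (0 : ℂ) 1, ‖q n w‖ ≤ M) :
    ∃ (φ : ℕ → ℕ) (Q : ℂ → ℂ), StrictMono φ ∧ DifferentiableOn ℂ Q (ball 0 1) ∧
      ∀ w ∈ ball (0 : ℂ) 1, Tendsto (fun n => q (φ n) w) atTop (𝓝 (Q w)) := by
  set c : ℕ → ℕ → ℂ := fun n k => ((k.factorial : ℂ))⁻¹ * iteratedDeriv k (q n) 0 with hc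
  have hcM : ∀ n k, ‖c n k‖ ≤ M := fun n k => norm_taylor_coeff_le (hq n) (hM n) k
  -- The Taylor coefficients lie in a product of compact discs, so a subsequence converges
  -- coefficientwise.
  obtain ⟨d, hd, φ, hφ, hlim⟩ := (isCompact_univ_pi fun _ : ℕ =>
    isCompact_closedBall (0 : ℂ) M).tendsto_subseq (x := c) fun n k _ => by simpa using hcM n k
  rw [tendsto_pi_nhds] at hlim
  have hdM : ∀ k, ‖d k‖ ≤ M := fun k => by simpa using hd k (Set.mem_univ k)
  refine ⟨φ, fun w => ∑' k, d k * w ^ k, hφ, ?_, ?_⟩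
  · intro w hw
    obtain ⟨ρ, h1, h2⟩ := exists_between (mem_ball_zero_iff.1 hw)
    have hρ0 : 0 ≤ ρ := (norm_nonneg w).trans h1.le
    have := Complex.differentiableOn_tsum_of_summable_norm (U := ball (0 : ℂ) ρ)
      (F := fun k w => d k * w ^ k) (u := fun k => M * ρ ^ k)
      ((summable_geometric_of_lt_one hρ0 h2).mul_left M) (fun k => by fun_prop) isOpen_ball
      (fun k v hv => by
        rw [norm_mul, norm_pow]
        exact mul_le_mul (hdM k) (pow_le_pow_left₀ (norm_nonneg _) (mem_ball_zero_iff.1 hv).le _)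
          (by positivity) ((norm_nonneg _).trans (hdM k)))
    exact (this.differentiableAt (isOpen_ball.mem_nhds
      (by simpa using h1))).differentiableWithinAt
  · intro w hw
    have hsum : ∀ n, q (φ n) w = ∑' k, c (φ n) k * w ^ k := by
      intro n
      have := Complex.taylorSeries_eq_on_ball' hw (hq (φ n))
      simp only [sub_zero] at this
      exact this.symm
    simp only [hsum]
    refine tendsto_tsum_of_dominated_convergence (bound := fun k => M * ‖w‖ ^ k)
      ((summable_geometric_of_lt_one (norm_nonneg w) (mem_ball_zero_iff.1 hw)).mul_left M) ?_ ?_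
    · intro k
      exact (hlim k).mul_const _
    · refine Eventually.of_forall fun n k => ?_
      rw [norm_mul, norm_pow]
      exact mul_le_mul_of_nonneg_right (hcM _ _) (by positivity)

/-! ### The scalar lens problem: existence and symmetry. -/

/-- `q` is holomorphic on the disc and `a + b q` takes values in the closed lens of level `c`. -/
def IsFeasible (a b : ℂ → ℂ) (c : ℝ) (q : ℂ → ℂ) : Prop :=
  DifferentiableOn ℂ q (ball 0 1) ∧
    ∀ w ∈ ball (0 : ℂ) 1, ‖1 + (a w + b w * q w)‖ ≤ c ∧ ‖1 - (a w + b w * q w)‖ ≤ c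

theorem norm_le_of_lens {f : ℂ} {c : ℝ} (h1 : ‖1 + f‖ ≤ c) (h2 : ‖1 - f‖ ≤ c) : ‖f‖ ≤ c := by
  have h3 : ‖(1 + f) - (1 - f)‖ ≤ c + c := (norm_sub_le _ _).trans (add_le_add h1 h2)
  rw [show (1 + f) - (1 - f) = 2 * f by ring, norm_mul, Complex.norm_ofNat] at h3
  linarith

/-- Two candidates f ± d with mean f: the surplus ‖d‖² is the strict convexity behind uniqueness. -/
theorem lens_parallelogram (f d : ℂ) :
    ‖1 + (f + d)‖ ^ 2 + ‖1 + (f - d)‖ ^ 2 = 2 * (‖1 + f‖ ^ 2 + ‖d‖ ^ 2) := by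
  have := parallelogram_law_with_norm ℂ (1 + f) d
  rw [show 1 + (f + d) = 1 + f + d by ring, show 1 + (f - d) = 1 + f - d by ring]
  nlinarith

theorem lens_parallelogram' (f d : ℂ) :
    ‖1 - (f + d)‖ ^ 2 + ‖1 - (f - d)‖ ^ 2 = 2 * (‖1 - f‖ ^ 2 + ‖d‖ ^ 2) := by
  have := parallelogram_law_with_norm ℂ (1 - f) d
  rw [show 1 - (f + d) = 1 - f - d by ring, show 1 - (f - d) = 1 - f + d by ring]
  nlinarith

/-- Competitors need not be real symmetric, so a later perturbation may be arbitrary. -/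
theorem exists_minimizer {a b : ℂ → ℂ} (ha : ∃ C : ℝ, ∀ w ∈ ball (0 : ℂ) 1, ‖a w‖ ≤ C)
    (hb : ContinuousOn b (closedBall 0 1)) (hbT : ∀ w ∈ sphere (0 : ℂ) 1, b w ≠ 0) :
    ∃ (γ : ℝ) (q : ℂ → ℂ), IsFeasible a b γ q ∧ ∀ c p, IsFeasible a b c p → γ ≤ c := by
  set Γ : Set ℝ := {c | ∃ q, IsFeasible a b c q} with hΓ
  have hne : Γ.Nonempty := by
    obtain ⟨C, hC⟩ := ha
    refine ⟨1 + C, fun _ => 0, by fun_prop, fun w hw => ?_⟩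
    have := hC w hw
    simp only [mul_zero, add_zero]
    exact ⟨(norm_add_le _ _).trans (by simpa using this),
      (norm_sub_le _ _).trans (by simpa using this)⟩
  have hbdd : BddBelow Γ := ⟨0, by
    rintro c ⟨q, -, hq⟩
    exact (norm_nonneg _).trans (hq 0 (by simp)).1⟩
  obtain ⟨u, -, hu, hmem⟩ := exists_seq_tendsto_sInf hne hbdd
  choose q hqd hq using hmem
  obtain ⟨B, hB⟩ := hu.bddAbove_range
  obtain ⟨M, hM⟩ := exists_uniform_bound ha hb hbT B
  obtain ⟨φ, Q, hφ, hQ, hlim⟩ := exists_subseq_tendsto_of_bounded hqd (M := M) fun n =>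
    hM (q n) (hqd n) fun w hw =>
      (norm_le_of_lens (hq n w hw).1 (hq n w hw).2).trans (hB ⟨n, rfl⟩)
  refine ⟨sInf Γ, Q, ⟨hQ, fun w hw => ?_⟩, fun c p hp => csInf_le hbdd ⟨p, hp⟩⟩
  have hu' := hu.comp hφ.tendsto_atTop
  have hf : Tendsto (fun n => a w + b w * q (φ n) w) atTop (𝓝 (a w + b w * Q w)) :=
    ((hlim w hw).const_mul _).const_add _
  exact ⟨le_of_tendsto_of_tendsto' (hf.const_add 1).norm hu' fun n => (hq (φ n) w hw).1,
    le_of_tendsto_of_tendsto' (hf.const_sub 1).norm hu' fun n => (hq (φ n) w hw).2⟩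

theorem conj_mem_ball {w : ℂ} (hw : w ∈ ball (0 : ℂ) 1) : conj w ∈ ball (0 : ℂ) 1 := by
  simpa using hw

theorem differentiableOn_conj_conj {q : ℂ → ℂ} (hq : DifferentiableOn ℂ q (ball 0 1)) :
    DifferentiableOn ℂ (fun w => conj (q (conj w))) (ball 0 1) := by
  intro w hw
  have := (hq.differentiableAt (isOpen_ball.mem_nhds (conj_mem_ball hw))).conj_conj
  rw [Complex.conj_conj] at this
  exact this.differentiableWithinAt

/-- Averaging with the reflected function makes a feasible function real symmetric. -/
theorem IsFeasible.symmetrize {a b q : ℂ → ℂ} {c : ℝ}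
    (ha : ∀ w ∈ ball (0 : ℂ) 1, a (conj w) = conj (a w))
    (hb : ∀ w ∈ ball (0 : ℂ) 1, b (conj w) = conj (b w)) (hq : IsFeasible a b c q) :
    IsFeasible a b c (fun w => (q w + conj (q (conj w))) / 2) := by
  refine ⟨(hq.1.add (differentiableOn_conj_conj hq.1)).div_const 2, fun w hw => ?_⟩
  obtain ⟨h1, h2⟩ := hq.2 w hw
  obtain ⟨h3, h4⟩ := hq.2 _ (conj_mem_ball hw)
  have e : conj (a (conj w) + b (conj w) * q (conj w)) = a w + b w * conj (q (conj w)) := by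
    rw [map_add, map_mul, ha w hw, hb w hw, Complex.conj_conj, Complex.conj_conj]
  rw [← Complex.norm_conj, map_add, map_one, e] at h3
  rw [← Complex.norm_conj, map_sub, map_one, e] at h4
  constructor
  · rw [show 1 + (a w + b w * ((q w + conj (q (conj w))) / 2)) =
      ((1 + (a w + b w * q w)) + (1 + (a w + b w * conj (q (conj w))))) / 2 by ring,
      norm_div, Complex.norm_ofNat]
    linarith [norm_add_le (1 + (a w + b w * q w)) (1 + (a w + b w * conj (q (conj w))))]
  · rw [show 1 - (a w + b w * ((q w + conj (q (conj w))) / 2)) =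
      ((1 - (a w + b w * q w)) + (1 - (a w + b w * conj (q (conj w))))) / 2 by ring,
      norm_div, Complex.norm_ofNat]
    linarith [norm_add_le (1 - (a w + b w * q w)) (1 - (a w + b w * conj (q (conj w))))]

theorem IsFeasible.inHinf {a b q : ℂ → ℂ} {c : ℝ}
    (ha : ∃ C : ℝ, ∀ w ∈ ball (0 : ℂ) 1, ‖a w‖ ≤ C)
    (hb : ContinuousOn b (closedBall 0 1)) (hbT : ∀ w ∈ sphere (0 : ℂ) 1, b w ≠ 0)
    (hq : IsFeasible a b c q) (hs : ∀ w ∈ ball (0 : ℂ) 1, q (conj w) = conj (q w)) :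
    InHinf q := by
  obtain ⟨M, hM⟩ := exists_uniform_bound ha hb hbT c
  exact ⟨hq.1, ⟨M, hM q hq.1 fun w hw => norm_le_of_lens (hq.2 w hw).1 (hq.2 w hw).2⟩, hs⟩

/-- If `a + b q` extends continuously to the closed disc, so does `q`. -/
theorem exists_inA_of_continuousOn {a b q Φ : ℂ → ℂ} (ha : ContinuousOn a (closedBall 0 1))
    (hb : ContinuousOn b (closedBall 0 1)) (hbT : ∀ w ∈ sphere (0 : ℂ) 1, b w ≠ 0)
    (hq : InHinf q) (hΦ : ContinuousOn Φ (closedBall 0 1))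
    (h : ∀ w ∈ ball (0 : ℂ) 1, a w + b w * q w = Φ w) :
    ∃ S, InA S ∧ ∀ w ∈ ball (0 : ℂ) 1, S w = q w := by
  classical
  set S : ℂ → ℂ := fun w => if w ∈ ball (0 : ℂ) 1 then q w else (Φ w - a w) / b w with hS
  have hSq : ∀ w ∈ ball (0 : ℂ) 1, S w = q w := fun w hw => if_pos hw
  have hSb : ∀ w ∈ closedBall (0 : ℂ) 1, b w ≠ 0 → S w = (Φ w - a w) / b w := by
    intro w hw hbw
    by_cases hwb : w ∈ ball (0 : ℂ) 1
    · rw [hSq w hwb, ← h w hwb]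
      field_simp
      ring
    · exact if_neg hwb
  refine ⟨S, ⟨⟨hq.1.congr hSq, ?_, fun w hw => ?_⟩, fun w hw => ?_⟩, hSq⟩
  · obtain ⟨C, hC⟩ := hq.2.1
    exact ⟨C, fun w hw => by rw [hSq w hw]; exact hC w hw⟩
  · rw [hSq w hw, hSq _ (conj_mem_ball hw), hq.2.2 w hw]
  · by_cases hwb : w ∈ ball (0 : ℂ) 1
    · refine ContinuousAt.continuousWithinAt ?_
      have := (hq.1.differentiableAt (isOpen_ball.mem_nhds hwb)).continuousAt
      exact this.congr (by
        filter_upwards [isOpen_ball.mem_nhds hwb] with v hv using (hSq v hv).symm)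
    · have hws : w ∈ sphere (0 : ℂ) 1 := by
        rw [mem_sphere_zero_iff_norm]
        rw [mem_closedBall_zero_iff] at hw
        rw [mem_ball_zero_iff] at hwb
        linarith
      have hbw := hbT w hws
      -- Near a point of the circle b ≠ 0, and one quotient formula describes `S` both inside and on
      -- the circle.
      have h1 : ContinuousWithinAt (fun v => (Φ v - a v) / b v) (closedBall 0 1) w :=
        ((hΦ w hw).sub (ha w hw)).div (hb w hw) hbw
      refine h1.congr_of_eventuallyEq ?_ (hSb w hw hbw)
      filter_upwards [(hb w hw).eventually_ne hbw, self_mem_nhdsWithin] with v hv hv2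
      exact hSb v hv2 hv

/-! ### Structure of the scalar minimizers. -/

/-- If a + b q = c, then q = (c - a) / b is rational and continuous up to the circle, hence agrees
on the disc with a function in `RA`. -/
theorem not_const_of_inHinf {a b : ℂ → ℂ} (ha : InRA a) (hb : InRA b)
    (hbT : ∀ w ∈ sphere (0 : ℂ) 1, b w ≠ 0)
    (hab : ∀ q : ℂ → ℂ, InRA q → ¬ ∃ c : ℂ, ∀ w ∈ ball (0 : ℂ) 1, a w + b w * q w = c)
    {P R : ℂ[X]} (hP : P ≠ 0)
    (hbPR : ∀ w ∈ ball (0 : ℂ) 1, b w * R.eval w = P.eval w)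
    {q : ℂ → ℂ} (hq : InHinf q) : ¬ ∃ c : ℂ, ∀ w ∈ ball (0 : ℂ) 1, a w + b w * q w = c := by
  rintro ⟨c, hc⟩
  obtain ⟨S, hS, hSq⟩ := exists_inA_of_continuousOn ha.1.2 hb.1.2 hbT hq
    (continuousOn_const (c := c)) hc
  obtain ⟨Pa, Ra, hRa, haPR⟩ := ha.2
  refine hab S ⟨hS, (C c * Ra - Pa) * R, P * Ra, mul_ne_zero hP hRa, fun w hw => ?_⟩
    ⟨c, fun w hw => by rw [hSq w hw]; exact hc w hw⟩
  have h1 := hc w hw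
  have h2 := haPR w hw
  have h3 := hbPR w hw
  rw [← hSq w hw] at h1
  simp only [eval_mul, eval_sub, eval_C]
  rw [← h2, ← h3]
  linear_combination (R.eval w * Ra.eval w) * h1

theorem exists_numerator {b : ℂ → ℂ} (hb : InRA b) (hbT : ∀ w ∈ sphere (0 : ℂ) 1, b w ≠ 0) :
    ∃ P R : ℂ[X], R ≠ 0 ∧ P ≠ 0 ∧ ∀ w ∈ ball (0 : ℂ) 1, b w * R.eval w = P.eval w := by
  obtain ⟨P, R, hR, h⟩ := hb.2
  refine ⟨P, R, hR, ?_, h⟩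
  rintro rfl
  obtain ⟨ρ, hρ0, hρ1, hρ⟩ := exists_radius_lt_of_sphere (c := 0) hb.1.2.norm
    (fun w hw => norm_pos_iff.2 (hbT w hw))
  -- With P = 0 the denominator would vanish wherever b does not, in particular on a whole radial
  -- interval.
  have hsub : (fun x : ℝ => (x : ℂ)) '' Set.Ioo ρ 1 ⊆ R.rootSet ℂ := by
    rintro _ ⟨x, hx, rfl⟩
    have hx0 : 0 < x := hρ0.trans hx.1
    have hxn : ‖(x : ℂ)‖ = x := by rw [Complex.norm_real, Real.norm_of_nonneg hx0.le]
    have hxb : (x : ℂ) ∈ ball (0 : ℂ) 1 := by rw [mem_ball_zero_iff, hxn]; exact hx.2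
    have h1 := h _ hxb
    have h2 := hρ _ (ball_subset_closedBall hxb) (by rw [hxn]; exact hx.1.le)
    rw [eval_zero] at h1
    rw [mem_rootSet]
    refine ⟨hR, ?_⟩
    have := (mul_eq_zero.1 h1).resolve_left (norm_pos_iff.1 h2)
    simpa [Polynomial.aeval_def] using this
  have hfin := (R.rootSet_finite ℂ).subset hsub
  exact (Set.Ioo_infinite hρ1) (hfin.of_finite_image Complex.ofReal_injective.injOn)

/-- Local Lipschitz estimate for the composition of a holomorphic function on the disc with two
functions congruent modulo `P`. -/
theorem comp_sub_comp_isBigO {F g h k : ℂ → ℂ} {P : ℂ[X]}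
    (hF : DifferentiableOn ℂ F (ball 0 1)) (hg : DifferentiableOn ℂ g (ball 0 1))
    (hh : DifferentiableOn ℂ h (ball 0 1)) (hk : DifferentiableOn ℂ k (ball 0 1))
    (hgm : Set.MapsTo g (ball 0 1) (ball 0 1)) (hhm : Set.MapsTo h (ball 0 1) (ball 0 1))
    (hgh : ∀ w ∈ ball (0 : ℂ) 1, g w - h w = P.eval w * k w) {w : ℂ}
    (hw : w ∈ ball (0 : ℂ) 1) :
    (fun v => F (h v) - F (g v)) =O[𝓝 w] fun v => P.eval v := by
  obtain ⟨ρ, h1, h2⟩ := exists_between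
    (max_lt (mem_ball_zero_iff.1 (hgm hw)) (mem_ball_zero_iff.1 (hhm hw)))
  have hdF := hF.deriv isOpen_ball
  obtain ⟨K, hK⟩ := (isCompact_closedBall (0 : ℂ) ρ).exists_bound_of_continuousOn
    (hdF.continuousOn.mono (closedBall_subset_ball h2))
  have hgc := (hg.differentiableAt (isOpen_ball.mem_nhds hw)).continuousAt
  have hhc := (hh.differentiableAt (isOpen_ball.mem_nhds hw)).continuousAt
  have hkc := (hk.differentiableAt (isOpen_ball.mem_nhds hw)).continuousAt
  have hbig : (fun v => P.eval v * k v) =O[𝓝 w] fun v => P.eval v := by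
    simpa using (Asymptotics.isBigO_refl (fun v => P.eval v) (𝓝 w)).mul
      (hkc.tendsto.isBigO_one ℂ)
  refine Asymptotics.IsBigO.trans (Asymptotics.IsBigO.of_bound K ?_) hbig
  filter_upwards [hgc.preimage_mem_nhds (isOpen_ball.mem_nhds
      (show g w ∈ ball (0 : ℂ) ρ by simpa using (le_max_left _ _).trans_lt h1)),
    hhc.preimage_mem_nhds (isOpen_ball.mem_nhds
      (show h w ∈ ball (0 : ℂ) ρ by simpa using (le_max_right _ _).trans_lt h1)),
    isOpen_ball.mem_nhds hw] with v hv1 hv2 hv3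
  rw [← hgh v hv3, norm_sub_rev (g v)]
  exact (convex_ball (0 : ℂ) ρ).norm_image_sub_le_of_norm_deriv_le (f := F)
    (fun x hx => hF.differentiableAt (isOpen_ball.mem_nhds (ball_subset_ball h2.le hx)))
    (fun x hx => hK x (ball_subset_closedBall hx)) hv1 hv2

/-- The structure of the scalar minimizers. -/
theorem minimizer_eq_lensMap_comp {a b : ℂ → ℂ} (ha : InRA a) (hb : InRA b)
    (hbT : ∀ w ∈ sphere (0 : ℂ) 1, b w ≠ 0)
    (hab : ∀ q : ℂ → ℂ, InRA q → ¬ ∃ c : ℂ, ∀ w ∈ ball (0 : ℂ) 1, a w + b w * q w = c)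
    {γ : ℝ} (hmin : ∀ c p, IsFeasible a b c p → γ ≤ c) {q : ℂ → ℂ} (hq : InHinf q)
    (hqγ : IsFeasible a b γ q) :
    1 < γ ∧ ∃ p : ℂ → ℂ, InRA p ∧
        (¬ ∃ c : ℂ, ∀ w ∈ ball (0 : ℂ) 1, p w = c) ∧
        (∀ w ∈ sphere (0 : ℂ) 1, ‖p w‖ = 1) ∧ (∀ w ∈ ball (0 : ℂ) 1, p w ∈ ball (0 : ℂ) 1) ∧
        ∀ w ∈ ball (0 : ℂ) 1, a w + b w * q w = lensMap γ (p w) := by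
  obtain ⟨P, R, -, hP, hPR⟩ := exists_numerator hb hbT
  have hnc := not_const_of_inHinf ha hb hbT hab hP hPR hq
  have had := ha.1.1.1
  have hbd := hb.1.1.1
  have hqd := hq.1
  set f : ℂ → ℂ := fun w => a w + b w * q w with hf
  have hfd : DifferentiableOn ℂ f (ball 0 1) := had.add (hbd.mul hqd)
  -- For γ ≤ 1 the identity |1 + f|² + |1 - f|² = 2 + 2|f|² forces f = 0.
  have hγ : 1 < γ := by
    by_contra hcon
    push Not at hcon
    refine hnc ⟨0, fun w hw => ?_⟩
    obtain ⟨h1, h2⟩ := hqγ.2 w hw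
    have h3 := parallelogram_law_with_norm ℂ 1 (f w)
    rw [norm_one] at h3
    have h4 : ‖f w‖ = 0 := by
      nlinarith [norm_nonneg (f w), norm_nonneg (1 + f w), norm_nonneg (1 - f w)]
    exact norm_eq_zero.1 h4
  refine ⟨hγ, ?_⟩
  have hfl : ∀ w ∈ ball (0 : ℂ) 1, f w ∈ lens γ := by
    intro w hw
    constructor
    · refine (hqγ.2 w hw).1.lt_of_ne fun h => hnc ⟨f w, fun v hv => ?_⟩
      exact add_left_cancel (eq_const_of_norm_max (hfd.const_add 1)
        (fun v hv => (hqγ.2 v hv).1) hw h v hv)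
    · refine (hqγ.2 w hw).2.lt_of_ne fun h => hnc ⟨f w, fun v hv => ?_⟩
      exact sub_right_injective (eq_const_of_norm_max (hfd.const_sub 1)
        (fun v hv => (hqγ.2 v hv).2) hw h v hv)
  set g : ℂ → ℂ := fun w => lensInv γ (f w) with hg
  have hgd : DifferentiableOn ℂ g (ball 0 1) := (differentiableOn_lensInv hγ).comp hfd hfl
  have hgm : Set.MapsTo g (ball 0 1) (ball 0 1) := fun w hw => lensInv_mem_ball hγ (hfl w hw)
  have hFg : ∀ w ∈ ball (0 : ℂ) 1, lensMap γ (g w) = f w := fun w hw =>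
    lensMap_lensInv hγ (hfl w hw)
  have hgs : ∀ w ∈ ball (0 : ℂ) 1, g (conj w) = conj (g w) := by
    intro w hw
    rw [hg]
    simp only
    rw [← lensInv_conj hγ (hfl w hw), hf]
    simp only
    rw [ha.1.1.2.2 w hw, hb.1.1.2.2 w hw, hq.2.2 w hw, map_add, map_mul]
  rcases schur_dichotomy _ P g hP rfl hgd (fun w hw => (mem_ball_zero_iff.1 (hgm hw)).le) with
    ⟨h, k, r, hr, hh, hk, H⟩ | ⟨N, D, hD, hN, H⟩
  · exfalso
    have hhm : Set.MapsTo h (ball 0 1) (ball 0 1) := fun w hw => by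
      simpa using (H w hw).1.trans_lt hr
    obtain ⟨ψ, hψ, hφψ⟩ := exists_eq_mul_of_isBigO _ P
      (fun w => lensMap γ (h w) - lensMap γ (g w)) hP rfl
      (((differentiableOn_lensMap hγ).comp hh hhm).sub ((differentiableOn_lensMap hγ).comp hgd hgm))
      (fun w hw => comp_sub_comp_isBigO (differentiableOn_lensMap hγ) hgd hh hk hgm hhm
        (fun v hv => (H v hv).2) hw)
    have h0 : (0 : ℂ) ∈ ball (0 : ℂ) 1 := by simp
    -- F_γ maps |u| ≤ r to a compact part of the open lens, so F_γ ∘ h has level below γ.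
    have hcont : ContinuousOn (fun u => max ‖1 + lensMap γ u‖ ‖1 - lensMap γ u‖)
        (closedBall 0 r) := by
      have := (differentiableOn_lensMap hγ).continuousOn.mono (closedBall_subset_ball hr)
      exact (this.const_add 1).norm.sup (continuousOn_const.sub this).norm
    obtain ⟨x, hx, hmax⟩ := (isCompact_closedBall (0 : ℂ) r).exists_isMaxOn
      ⟨h 0, by simpa using (H 0 h0).1⟩ hcont
    have hxl := lensMap_mem_lens hγ (closedBall_subset_ball hr hx)
    have hlt := max_lt hxl.1 hxl.2
    -- Since b R = P, adding R ψ to q adds P ψ = F_γ(h) - F_γ(g) to f.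
    refine (hmin _ (fun w => q w + R.eval w * ψ w) ⟨?_, fun w hw => ?_⟩).not_gt hlt
    · exact hqd.add (DifferentiableOn.mul (by fun_prop) hψ)
    · have e : a w + b w * (q w + R.eval w * ψ w) = lensMap γ (h w) := by
        have e1 := hφψ w hw
        rw [← hPR w hw, hFg w hw, hf] at e1
        simp only at e1
        linear_combination -e1
      rw [e]
      have := hmax (show h w ∈ closedBall 0 r by simpa using (H w hw).1)
      exact ⟨(le_max_left _ _).trans this, (le_max_right _ _).trans this⟩
  -- The quotient N / D replaces `g` because values on the circle are needed.
  · obtain ⟨p, hp⟩ : ∃ p : ℂ → ℂ, ∀ w, p w = N.eval w / D.eval w := ⟨_, fun _ => rfl⟩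
    have hpg : ∀ w ∈ ball (0 : ℂ) 1, p w = g w := by
      intro w hw
      rw [hp, ← H w hw, mul_div_cancel_right₀ _ (hD w (ball_subset_closedBall hw)).1]
    refine ⟨p, ⟨⟨⟨?_, ?_, ?_⟩, ?_⟩, N, D, ?_, ?_⟩, ?_, ?_, ?_, ?_⟩
    · exact hgd.congr hpg
    · exact ⟨1, fun w hw => by rw [hpg w hw]; exact (mem_ball_zero_iff.1 (hgm hw)).le⟩
    · intro w hw
      rw [hpg w hw, hpg _ (conj_mem_ball hw), hgs w hw]
    · rw [funext hp]
      exact N.continuous.continuousOn.div D.continuous.continuousOn fun w hw => (hD w hw).1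
    · rintro rfl
      exact (hD 0 (by simp)).1 (by simp)
    · intro w hw
      rw [hpg w hw, H w hw]
    · rintro ⟨c, hc⟩
      refine hnc ⟨lensMap γ c, fun w hw => ?_⟩
      rw [← hc w hw, hpg w hw, hFg w hw]
    · intro w hw
      rw [hp, norm_div, hN w hw, div_self (norm_ne_zero_iff.2 (hD w (sphere_subset_closedBall hw)).1)]
    · intro w hw
      rw [hpg w hw]
      exact hgm hw
    · intro w hw
      rw [hpg w hw, hFg w hw]

theorem mapsTo_closedBall_of_unimodular {p : ℂ → ℂ}
    (hpT : ∀ w ∈ sphere (0 : ℂ) 1, ‖p w‖ = 1)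
    (hpb : ∀ w ∈ ball (0 : ℂ) 1, p w ∈ ball (0 : ℂ) 1) :
    Set.MapsTo p (closedBall 0 1) (closedBall 0 1) := by
  intro w hw
  rcases (mem_closedBall_zero_iff.1 hw).lt_or_eq with h1 | h1
  · exact ball_subset_closedBall (hpb w (by simpa using h1))
  · simpa using (hpT w (by simpa using h1)).le

/-! ### Uniqueness for the scalar problem. -/

/-- A minimizer admits no room near the circle. -/
theorem eq_zero_of_lens_defect {γ : ℝ} (hγ : 1 < γ) {f d p : ℂ → ℂ} (hp : InA p)
    (hpT : ∀ w ∈ sphere (0 : ℂ) 1, ‖p w‖ = 1)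
    (hpb : ∀ w ∈ ball (0 : ℂ) 1, p w ∈ ball (0 : ℂ) 1)
    (hf : ∀ w ∈ ball (0 : ℂ) 1, f w = lensMap γ (p w))
    (hd : DifferentiableOn ℂ d (ball 0 1))
    (h : ∀ w ∈ ball (0 : ℂ) 1, ‖1 + f w‖ ^ 2 + ‖d w‖ ^ 2 ≤ γ ^ 2 ∧
      ‖1 - f w‖ ^ 2 + ‖d w‖ ^ 2 ≤ γ ^ 2) :
    ∀ w ∈ ball (0 : ℂ) 1, d w = 0 := by
  have hpc := mapsTo_closedBall_of_unimodular hpT hpb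
  have hE : ContinuousOn (fun w => lensExt γ (p w)) (closedBall 0 1) :=
    (continuousOn_lensExt hγ).comp hp.2 hpc
  have hfE : ∀ w ∈ ball (0 : ℂ) 1, lensExt γ (p w) = f w := fun w hw => by
    rw [hf w hw, lensExt_eq_of_mem_ball hγ (hpb w hw)]
  have hsmall : ∀ ε > 0, ∀ w ∈ ball (0 : ℂ) 1, ‖d w‖ ≤ ε := by
    intro ε hε
    obtain ⟨ρ, hρ0, hρ1, hρ⟩ := exists_radius_lt_of_sphere
      (m := fun w => max (‖1 + lensExt γ (p w)‖ ^ 2) (‖1 - lensExt γ (p w)‖ ^ 2))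
      (((hE.const_add 1).norm.pow 2).sup ((continuousOn_const.sub hE).norm.pow 2)) (c := γ ^ 2 - ε ^ 2) (by
        intro w hw
        have hε2 : 0 < ε ^ 2 := by positivity
        rcases lensExt_sphere hγ (w := p w) (by simpa using hpT w hw) with h1 | h1
        · exact lt_max_of_lt_left (by rw [h1]; linarith)
        · exact lt_max_of_lt_right (by rw [h1]; linarith))
    -- Near the circle one of |1 ± f|² exceeds γ² - ε², which leaves at most ε² for |d|².
    refine norm_le_of_annulus hd hρ0 hρ1 fun w hw hw1 => ?_
    have h1 := hρ w (ball_subset_closedBall hw) hw1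
    rw [hfE w hw] at h1
    obtain ⟨h2, h3⟩ := h w hw
    refine le_of_sq_le_sq ?_ hε.le
    rcases lt_max_iff.1 h1 with h4 | h4 <;> linarith
  intro w hw
  exact norm_le_zero_iff.1 (le_of_forall_pos_le_add fun ε hε => by
    simpa using hsmall ε hε w hw)

/-- Two feasible functions with controlled mean square coincide. -/
theorem eq_of_mean_square_le {a b : ℂ → ℂ} (ha : InRA a) (hb : InRA b)
    (hbT : ∀ w ∈ sphere (0 : ℂ) 1, b w ≠ 0)
    (hab : ∀ q : ℂ → ℂ, InRA q → ¬ ∃ c : ℂ, ∀ w ∈ ball (0 : ℂ) 1, a w + b w * q w = c)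
    {γ : ℝ} (hmin : ∀ c p, IsFeasible a b c p → γ ≤ c) (hγ0 : 0 ≤ γ) {q₁ q₂ : ℂ → ℂ}
    (hq₁ : InHinf q₁) (hq₂ : InHinf q₂)
    (h : ∀ w ∈ ball (0 : ℂ) 1,
      ‖1 + (a w + b w * q₁ w)‖ ^ 2 + ‖1 + (a w + b w * q₂ w)‖ ^ 2 ≤ 2 * γ ^ 2 ∧
      ‖1 - (a w + b w * q₁ w)‖ ^ 2 + ‖1 - (a w + b w * q₂ w)‖ ^ 2 ≤ 2 * γ ^ 2) :
    ∀ w ∈ ball (0 : ℂ) 1, q₁ w = q₂ w := by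
  set q : ℂ → ℂ := fun w => (q₁ w + q₂ w) / 2 with hq
  set d : ℂ → ℂ := fun w => b w * ((q₁ w - q₂ w) / 2) with hd
  have key : ∀ w ∈ ball (0 : ℂ) 1, ‖1 + (a w + b w * q w)‖ ^ 2 + ‖d w‖ ^ 2 ≤ γ ^ 2 ∧
      ‖1 - (a w + b w * q w)‖ ^ 2 + ‖d w‖ ^ 2 ≤ γ ^ 2 := by
    intro w hw
    obtain ⟨h1, h2⟩ := h w hw
    have e1 : a w + b w * q₁ w = (a w + b w * q w) + d w := by simp only [hq, hd]; ring
    have e2 : a w + b w * q₂ w = (a w + b w * q w) - d w := by simp only [hq, hd]; ring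
    rw [e1, e2, lens_parallelogram] at h1
    rw [e1, e2, lens_parallelogram'] at h2
    constructor <;> linarith
  have hqH : InHinf q := by
    refine ⟨(hq₁.1.add hq₂.1).div_const 2, ?_, fun w hw => ?_⟩
    · obtain ⟨C₁, h1⟩ := hq₁.2.1
      obtain ⟨C₂, h2⟩ := hq₂.2.1
      refine ⟨(C₁ + C₂) / 2, fun w hw => ?_⟩
      rw [hq]
      simp only [norm_div, Complex.norm_ofNat]
      linarith [norm_add_le (q₁ w) (q₂ w), h1 w hw, h2 w hw]
    · simp only [hq, hq₁.2.2 w hw, hq₂.2.2 w hw, map_div₀, map_add, map_ofNat]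
  have hqf : IsFeasible a b γ q := ⟨hqH.1, fun w hw =>
    ⟨le_of_sq_le_sq (by nlinarith [key w hw, norm_nonneg (d w)]) hγ0,
      le_of_sq_le_sq (by nlinarith [key w hw, norm_nonneg (d w)]) hγ0⟩⟩
  obtain ⟨hγ, p, hp, -, hpT, hpb, hfp⟩ := minimizer_eq_lensMap_comp ha hb hbT hab hmin hqH hqf
  have hd0 := eq_zero_of_lens_defect hγ hp.1 hpT hpb hfp
    (hb.1.1.1.mul ((hq₁.1.sub hq₂.1).div_const 2)) key
  obtain ⟨ρ, hρ0, hρ1, hρ⟩ := exists_radius_lt_of_sphere (c := 0) hb.1.2.norm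
    (fun w hw => norm_pos_iff.2 (hbT w hw))
  intro w hw
  -- Zeros of b inside the disc are bypassed: q₁ - q₂ vanishes on an annulus, hence everywhere.
  have := norm_le_of_annulus (C := 0) (hq₁.1.sub hq₂.1) hρ0 hρ1 (by
    intro v hv hv1
    have h1 := norm_pos_iff.1 (hρ v (ball_subset_closedBall hv) hv1)
    have h2 := (mul_eq_zero.1 (hd0 v hv)).resolve_left h1
    have h3 : q₁ v - q₂ v = 0 := by
      have : (2 : ℂ) ≠ 0 := two_ne_zero
      simpa [div_eq_zero_iff] using h2
    simp [h3]) w hw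
  exact sub_eq_zero.1 (norm_le_zero_iff.1 this)

/-! ### Polynomial approximation. -/

theorem eval_map_conj (T : ℂ[X]) (w : ℂ) :
    (T.map (starRingEnd ℂ)).eval (conj w) = conj (T.eval w) := by
  rw [eval_map, eval₂_at_apply]

/-- Functions of class `A` are uniform limits of real symmetric polynomials. -/
theorem exists_polynomial_approx {S : ℂ → ℂ} (hS : InA S) {ε : ℝ} (hε : 0 < ε) :
    ∃ T : ℂ[X], (∀ w, T.eval (conj w) = conj (T.eval w)) ∧
      ∀ w ∈ ball (0 : ℂ) 1, ‖S w - T.eval w‖ ≤ ε := by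
  obtain ⟨M, hM⟩ := hS.1.2.1
  have hSd := hS.1.1
  obtain ⟨δ, hδ, hunif⟩ := Metric.uniformContinuousOn_iff.1
    ((isCompact_closedBall (0 : ℂ) 1).uniformContinuousOn_of_continuous hS.2) (ε / 2) (by positivity)
  -- The dilate S(rw) is within ε/2 of S, and its Taylor series converges uniformly on the disc.
  obtain ⟨r, hr0, hr1, hrδ⟩ : ∃ r : ℝ, 0 < r ∧ r < 1 ∧ 1 - r < δ :=
    ⟨max (1 / 2) (1 - δ / 2), by positivity, max_lt (by norm_num) (by linarith), by
      linarith [le_max_right (1 / 2) (1 - δ / 2)]⟩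
  set c : ℕ → ℂ := fun k => ((k.factorial : ℂ))⁻¹ * iteratedDeriv k S 0 with hc
  have hlim := tendstoUniformlyOn_tsum_nat (f := fun k (v : ℂ) => c k * v ^ k)
    (s := closedBall 0 r) ((summable_geometric_of_lt_one hr0.le hr1).mul_left M) (by
      intro k v hv
      rw [norm_mul, norm_pow]
      have := norm_taylor_coeff_le hSd hM k
      exact mul_le_mul this (pow_le_pow_left₀ (norm_nonneg _) (mem_closedBall_zero_iff.1 hv) _)
        (by positivity) ((norm_nonneg _).trans this))
  obtain ⟨N, hN⟩ := (Metric.tendstoUniformlyOn_iff.1 hlim (ε / 2) (by positivity)).exists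
  set T₀ : ℂ[X] := ∑ k ∈ Finset.range N, C (c k * (r : ℂ) ^ k) * X ^ k with hT₀
  have hT₀S : ∀ w ∈ ball (0 : ℂ) 1, ‖S w - T₀.eval w‖ ≤ ε := by
    intro w hw
    have hw1 := mem_ball_zero_iff.1 hw
    have hrw : ‖(r : ℂ) * w‖ = r * ‖w‖ := by
      rw [norm_mul, Complex.norm_real, Real.norm_of_nonneg hr0.le]
    have hrwb : ‖(r : ℂ) * w‖ < 1 := by rw [hrw]; nlinarith [norm_nonneg w]
    have h1 := hN ((r : ℂ) * w) (by
      rw [mem_closedBall_zero_iff, hrw]; nlinarith [norm_nonneg w])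
    have h2 := Complex.taylorSeries_eq_on_ball' (mem_ball_zero_iff.2 hrwb) hSd
    simp only [sub_zero] at h2
    simp only [hc] at h1
    rw [h2] at h1
    have h3 : T₀.eval w = ∑ k ∈ Finset.range N, c k * ((r : ℂ) * w) ^ k := by
      rw [hT₀, eval_finsetSum]
      refine Finset.sum_congr rfl fun k _ => ?_
      simp only [eval_mul, eval_C, eval_pow, eval_X]
      ring
    have h4 := hunif w (ball_subset_closedBall hw) ((r : ℂ) * w)
      (by simpa using hrwb.le) (by
        rw [dist_eq_norm, show w - (r : ℂ) * w = ((1 - r : ℝ) : ℂ) * w by push_cast; ring,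
          norm_mul, Complex.norm_real, Real.norm_of_nonneg (by linarith)]
        nlinarith [norm_nonneg w])
    rw [← dist_eq_norm, h3]
    exact (dist_triangle _ _ _).trans (by linarith)
  -- Averaging with the conjugated coefficients makes the polynomial real; the error bound persists
  -- as S is symmetric.
  refine ⟨C (1 / 2) * (T₀ + T₀.map (starRingEnd ℂ)), fun w => ?_, fun w hw => ?_⟩
  · have h1 := eval_map_conj T₀ w
    have h2 := eval_map_conj T₀ (conj w)
    rw [Complex.conj_conj] at h2
    simp only [eval_mul, eval_add, eval_C, h1, h2, map_mul, map_add, map_div₀, map_one, map_ofNat,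
      Complex.conj_conj]
    ring
  · have h1 := hT₀S w hw
    have h2 := hT₀S _ (conj_mem_ball hw)
    have h3 := eval_map_conj T₀ (conj w)
    rw [Complex.conj_conj] at h3
    rw [hS.1.2.2 w hw, ← Complex.norm_conj, map_sub, Complex.conj_conj, ← h3] at h2
    simp only [eval_mul, eval_add, eval_C]
    rw [show S w - 1 / 2 * (T₀.eval w + (T₀.map (starRingEnd ℂ)).eval w) =
      ((S w - T₀.eval w) + (S w - (T₀.map (starRingEnd ℂ)).eval w)) / 2 by ring,
      norm_div, Complex.norm_ofNat]
    linarith [norm_add_le (S w - T₀.eval w) (S w - (T₀.map (starRingEnd ℂ)).eval w)]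

/-! ### Singular values of the closed loop and reduction to the scalar problem. -/

theorem norm_toEuclideanLin_sq (x y : ℂ) (v : EuclideanSpace ℂ (Fin 2)) :
    ‖Matrix.toEuclideanLin !![1, y; x, 1] v‖ ^ 2 =
      ‖v 0 + y * v 1‖ ^ 2 + ‖x * v 0 + v 1‖ ^ 2 := by
  rw [EuclideanSpace.norm_sq_eq, Fin.sum_univ_two]
  simp [Matrix.toLpLin_apply, dotProduct, Fin.sum_univ_two]

theorem sigmaMax_nonneg {m k : ℕ} (M : Matrix (Fin m) (Fin k) ℂ) : 0 ≤ sigmaMax M := by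
  rw [sigmaMax_eq_opNorm]
  exact norm_nonneg _

theorem norm_toEuclideanLin_le {m k : ℕ} (M : Matrix (Fin m) (Fin k) ℂ)
    (v : EuclideanSpace ℂ (Fin k)) : ‖Matrix.toEuclideanLin M v‖ ≤ sigmaMax M * ‖v‖ := by
  rw [sigmaMax_eq_opNorm]
  exact (LinearMap.toContinuousLinearMap (Matrix.toEuclideanLin M)).le_opNorm v

theorem sigmaMax_le {m k : ℕ} {M : Matrix (Fin m) (Fin k) ℂ} {c : ℝ} (hc : 0 ≤ c)
    (h : ∀ v, ‖Matrix.toEuclideanLin M v‖ ^ 2 ≤ (c * ‖v‖) ^ 2) : sigmaMax M ≤ c := by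
  rw [sigmaMax_eq_opNorm]
  refine ContinuousLinearMap.opNorm_le_bound _ hc fun v => ?_
  exact le_of_sq_le_sq (h v) (mul_nonneg hc (norm_nonneg v))

/-- The test vectors are (1, 1) and (1, -1), of squared norm 2. -/
theorem sq_add_sq_le_sigmaMax (x y : ℂ) :
    ‖1 + x‖ ^ 2 + ‖1 + y‖ ^ 2 ≤ 2 * sigmaMax !![1, y; x, 1] ^ 2 ∧
      ‖1 - x‖ ^ 2 + ‖1 - y‖ ^ 2 ≤ 2 * sigmaMax !![1, y; x, 1] ^ 2 := by
  constructor
  · have h := norm_toEuclideanLin_le !![1, y; x, 1] !₂[1, 1]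
    have h2 := pow_le_pow_left₀ (norm_nonneg _) h 2
    rw [norm_toEuclideanLin_sq, mul_pow, EuclideanSpace.norm_sq_eq, Fin.sum_univ_two] at h2
    simp at h2
    rw [add_comm x 1] at h2
    linarith
  · have h := norm_toEuclideanLin_le !![1, y; x, 1] !₂[1, -1]
    have h2 := pow_le_pow_left₀ (norm_nonneg _) h 2
    rw [norm_toEuclideanLin_sq, mul_pow, EuclideanSpace.norm_sq_eq, Fin.sum_univ_two] at h2
    simp at h2
    rw [← sub_eq_add_neg, ← sub_eq_add_neg, norm_sub_rev x 1] at h2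
    linarith

/-- The orthogonal vectors (1, ±1) diagonalize the matrix, with eigenvalues 1 ± f. -/
theorem sigmaMax_le_of_lens {f : ℂ} {c : ℝ} (h1 : ‖1 + f‖ ≤ c) (h2 : ‖1 - f‖ ≤ c) :
    sigmaMax !![1, f; f, 1] ≤ c := by
  have hc : 0 ≤ c := (norm_nonneg _).trans h1
  refine sigmaMax_le hc fun v => ?_
  rw [norm_toEuclideanLin_sq, mul_pow, EuclideanSpace.norm_sq_eq, Fin.sum_univ_two]
  have e1 := parallelogram_law_with_norm ℂ (v 0 + f * v 1) (f * v 0 + v 1)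
  have e2 := parallelogram_law_with_norm ℂ (v 0) (v 1)
  rw [show v 0 + f * v 1 + (f * v 0 + v 1) = (1 + f) * (v 0 + v 1) by ring,
    show v 0 + f * v 1 - (f * v 0 + v 1) = (1 - f) * (v 0 - v 1) by ring, norm_mul, norm_mul] at e1
  have p1 := pow_le_pow_left₀ (mul_nonneg (norm_nonneg _) (norm_nonneg _))
    (mul_le_mul_of_nonneg_right h1 (norm_nonneg (v 0 + v 1))) 2
  have p2 := pow_le_pow_left₀ (mul_nonneg (norm_nonneg _) (norm_nonneg _))
    (mul_le_mul_of_nonneg_right h2 (norm_nonneg (v 0 - v 1))) 2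
  nlinarith

/-- Used only for boundedness, without which the real supremum in `hinfNorm` would default to 0. -/
theorem sigmaMax_le_crude (x y : ℂ) : sigmaMax !![1, y; x, 1] ≤ 2 + ‖x‖ + ‖y‖ := by
  refine sigmaMax_le (by positivity) fun v => ?_
  rw [norm_toEuclideanLin_sq]
  have h0 : ‖v 0‖ ≤ ‖v‖ := PiLp.norm_apply_le v 0
  have h1 : ‖v 1‖ ≤ ‖v‖ := PiLp.norm_apply_le v 1
  have a1 : ‖v 0 + y * v 1‖ ≤ (1 + ‖y‖) * ‖v‖ := by
    refine (norm_add_le _ _).trans ?_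
    rw [norm_mul]
    nlinarith [norm_nonneg y]
  have a2 : ‖x * v 0 + v 1‖ ≤ (1 + ‖x‖) * ‖v‖ := by
    refine (norm_add_le _ _).trans ?_
    rw [norm_mul]
    nlinarith [norm_nonneg x]
  have b1 := pow_le_pow_left₀ (norm_nonneg _) a1 2
  have b2 := pow_le_pow_left₀ (norm_nonneg _) a2 2
  have b3 : 0 ≤ ((1 + ‖y‖) * ‖v‖) * ((1 + ‖x‖) * ‖v‖) := by positivity
  nlinarith

theorem orderReversal_two : orderReversal 2 = !![0, 1; 1, 0] := by
  ext i j
  fin_cases i <;> fin_cases j <;> simp [orderReversal]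

theorem one_add_reversal_mul {α β : ℂ} {Q : Matrix (Fin 2) (Fin 2) ℂ} (hQ : Q.IsDiag) :
    1 + α • orderReversal 2 + β • orderReversal 2 * Q =
      !![1, α + β * Q 1 1; α + β * Q 0 0, 1] := by
  have h01 : Q 0 1 = 0 := hQ (by decide)
  have h10 : Q 1 0 = 0 := hQ (by decide)
  rw [orderReversal_two]
  ext i j
  fin_cases i <;> fin_cases j <;> simp [Matrix.vecMul, dotProduct, h01, h10]

theorem InHinf.congr {f g : ℂ → ℂ} (hf : InHinf f) (h : ∀ w ∈ ball (0 : ℂ) 1, g w = f w) :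
    InHinf g := by
  obtain ⟨h1, ⟨C, h2⟩, h3⟩ := hf
  refine ⟨h1.congr h, ⟨C, fun w hw => by rw [h w hw]; exact h2 w hw⟩, fun w hw => ?_⟩
  rw [h w hw, h _ (conj_mem_ball hw), h3 w hw]

theorem inRA_zero : InRA fun _ => 0 :=
  ⟨⟨⟨by fun_prop, ⟨0, by simp⟩, by simp⟩, by fun_prop⟩, 0, 1, one_ne_zero, by simp⟩

theorem InRAMat.inHinfMat {m k : ℕ} {G : ℂ → Matrix (Fin m) (Fin k) ℂ} (h : InRAMat G) :
    InHinfMat G := fun i r => (h i r).1.1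

theorem inRA_polynomial {T : ℂ[X]} (hT : ∀ w, T.eval (conj w) = conj (T.eval w)) :
    InRA fun w => T.eval w := by
  refine ⟨⟨⟨by fun_prop, ?_, fun w _ => hT w⟩, by fun_prop⟩, T, 1, one_ne_zero, by simp⟩
  obtain ⟨C, hC⟩ := (isCompact_closedBall (0 : ℂ) 1).exists_bound_of_continuousOn
    (f := fun w => T.eval w) (by fun_prop)
  exact ⟨C, fun w hw => hC w (ball_subset_closedBall hw)⟩

theorem isDiag_smul_one {n : ℕ} (s : ℂ) : (s • (1 : Matrix (Fin n) (Fin n) ℂ)).IsDiag :=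
  Matrix.isDiag_one.smul s

section Norm

variable {a b : ℂ → ℂ} {L₀ L₁ Q : ℂ → Matrix (Fin 2) (Fin 2) ℂ}

theorem closedLoop_eq (hL₀ : ∀ w, L₀ w = 1 + a w • orderReversal 2)
    (hL₁ : ∀ w, L₁ w = b w • orderReversal 2) (hQ : DiagOnDisc Q) {w : ℂ}
    (hw : w ∈ ball (0 : ℂ) 1) :
    L₀ w + L₁ w * Q w = !![1, a w + b w * Q w 1 1; a w + b w * Q w 0 0, 1] := by
  rw [hL₀, hL₁, one_add_reversal_mul (hQ w hw)]

theorem sigmaMax_le_hinfNorm (ha : InHinf a) (hb : InHinf b)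
    (hL₀ : ∀ w, L₀ w = 1 + a w • orderReversal 2)
    (hL₁ : ∀ w, L₁ w = b w • orderReversal 2) (hQH : InHinfMat Q) (hQ : DiagOnDisc Q) {w : ℂ}
    (hw : w ∈ ball (0 : ℂ) 1) :
    sigmaMax !![1, a w + b w * Q w 1 1; a w + b w * Q w 0 0, 1] ≤
      hinfNorm fun w => L₀ w + L₁ w * Q w := by
  obtain ⟨Ca, hCa⟩ := ha.2.1
  obtain ⟨Cb, hCb⟩ := hb.2.1
  obtain ⟨C₀, hC₀⟩ := (hQH 0 0).2.1
  obtain ⟨C₁, hC₁⟩ := (hQH 1 1).2.1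
  have hbound : ∀ v ∈ ball (0 : ℂ) 1, ∀ q C, ‖q‖ ≤ C → ‖a v + b v * q‖ ≤ Ca + Cb * C := by
    intro v hv q C hq
    refine (norm_add_le _ _).trans (add_le_add (hCa v hv) ?_)
    rw [norm_mul]
    exact mul_le_mul (hCb v hv) hq (norm_nonneg _) ((norm_nonneg _).trans (hCb v hv))
  rw [← closedLoop_eq hL₀ hL₁ hQ hw]
  refine le_csSup ⟨2 + (Ca + Cb * C₀) + (Ca + Cb * C₁), ?_⟩ ⟨w, hw, rfl⟩
  rintro _ ⟨v, hv, rfl⟩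
  simp only
  rw [closedLoop_eq hL₀ hL₁ hQ hv]
  refine (sigmaMax_le_crude _ _).trans ?_
  linarith [hbound v hv _ _ (hC₀ v hv), hbound v hv _ _ (hC₁ v hv)]

theorem mean_square_le_hinfNorm (ha : InHinf a) (hb : InHinf b)
    (hL₀ : ∀ w, L₀ w = 1 + a w • orderReversal 2)
    (hL₁ : ∀ w, L₁ w = b w • orderReversal 2) (hQH : InHinfMat Q) (hQ : DiagOnDisc Q) :
    0 ≤ (hinfNorm fun w => L₀ w + L₁ w * Q w) ∧ ∀ w ∈ ball (0 : ℂ) 1,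
      ‖1 + (a w + b w * Q w 0 0)‖ ^ 2 + ‖1 + (a w + b w * Q w 1 1)‖ ^ 2 ≤
        2 * (hinfNorm fun w => L₀ w + L₁ w * Q w) ^ 2 ∧
      ‖1 - (a w + b w * Q w 0 0)‖ ^ 2 + ‖1 - (a w + b w * Q w 1 1)‖ ^ 2 ≤
        2 * (hinfNorm fun w => L₀ w + L₁ w * Q w) ^ 2 := by
  refine ⟨(sigmaMax_nonneg _).trans
    (sigmaMax_le_hinfNorm ha hb hL₀ hL₁ hQH hQ (w := 0) (by simp)), fun w hw => ?_⟩
  have h1 := pow_le_pow_left₀ (sigmaMax_nonneg _)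
    (sigmaMax_le_hinfNorm ha hb hL₀ hL₁ hQH hQ hw) 2
  obtain ⟨h2, h3⟩ := sq_add_sq_le_sigmaMax (a w + b w * Q w 0 0) (a w + b w * Q w 1 1)
  constructor <;> linarith

theorem isFeasible_hinfNorm (ha : InHinf a) (hb : InHinf b)
    (hL₀ : ∀ w, L₀ w = 1 + a w • orderReversal 2)
    (hL₁ : ∀ w, L₁ w = b w • orderReversal 2) (hQH : InHinfMat Q) (hQ : DiagOnDisc Q) :
    IsFeasible a b (hinfNorm fun w => L₀ w + L₁ w * Q w)
      (fun w => (Q w 0 0 + Q w 1 1) / 2) := by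
  obtain ⟨h0, h⟩ := mean_square_le_hinfNorm ha hb hL₀ hL₁ hQH hQ
  refine ⟨((hQH 0 0).1.add (hQH 1 1).1).div_const 2, fun w hw => ?_⟩
  obtain ⟨h1, h2⟩ := h w hw
  set f := a w + b w * ((Q w 0 0 + Q w 1 1) / 2) with hf
  set d := b w * ((Q w 0 0 - Q w 1 1) / 2) with hd
  have e1 : a w + b w * Q w 0 0 = f + d := by rw [hf, hd]; ring
  have e2 : a w + b w * Q w 1 1 = f - d := by rw [hf, hd]; ring
  rw [e1, e2, lens_parallelogram] at h1
  rw [e1, e2, lens_parallelogram'] at h2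
  exact ⟨le_of_sq_le_sq (by nlinarith [norm_nonneg d]) h0,
    le_of_sq_le_sq (by nlinarith [norm_nonneg d]) h0⟩

theorem hinfNorm_le (hL₀ : ∀ w, L₀ w = 1 + a w • orderReversal 2)
    (hL₁ : ∀ w, L₁ w = b w • orderReversal 2) {S : ℂ → ℂ} {c : ℝ} (hS : IsFeasible a b c S)
    (hQ : ∀ w ∈ ball (0 : ℂ) 1, Q w = S w • (1 : Matrix (Fin 2) (Fin 2) ℂ)) :
    (hinfNorm fun w => L₀ w + L₁ w * Q w) ≤ c := by
  refine csSup_le (Set.Nonempty.image _ ⟨0, by simp⟩) ?_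
  rintro _ ⟨w, hw, rfl⟩
  simp only
  rw [closedLoop_eq hL₀ hL₁ (fun v hv => by rw [hQ v hv]; exact isDiag_smul_one _) hw, hQ w hw]
  simp only [Matrix.smul_apply, Matrix.one_apply_eq, smul_eq_mul, mul_one]
  exact sigmaMax_le_of_lens (hS.2 w hw).1 (hS.2 w hw).2

end Norm

theorem inHinfMat_smul_one {Q : ℂ → Matrix (Fin 2) (Fin 2) ℂ} {S : ℂ → ℂ} (hS : InHinf S)
    (hQ : ∀ w ∈ ball (0 : ℂ) 1, Q w = S w • (1 : Matrix (Fin 2) (Fin 2) ℂ)) : InHinfMat Q := by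
  intro i j
  by_cases hij : i = j
  · subst hij
    exact hS.congr fun w hw => by simp [hQ w hw]
  · exact inRA_zero.1.1.congr fun w hw => by simp [hQ w hw, Matrix.one_apply_ne hij]

theorem inRAMat_smul_one {S : ℂ → ℂ} (hS : InRA S) :
    InRAMat fun w => S w • (1 : Matrix (Fin 2) (Fin 2) ℂ) := by
  intro i j
  by_cases hij : i = j
  · subst hij
    simpa using hS
  · simpa [Matrix.one_apply_ne hij] using inRA_zero

/-! ### The main theorem. -/

theorem theorem2 (a b : ℂ → ℂ) (ha : InRA a) (hb : InRA b)
    (hbT : ∀ w ∈ Metric.sphere (0 : ℂ) 1, b w ≠ 0)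
    (hab : ∀ q : ℂ → ℂ, InRA q → ¬ ∃ c : ℂ, ∀ w ∈ Metric.ball (0 : ℂ) 1, a w + b w * q w = c)
    (L₀ L₁ : ℂ → Matrix (Fin 2) (Fin 2) ℂ)
    (hL₀ : ∀ w, L₀ w = 1 + a w • orderReversal 2)
    (hL₁ : ∀ w, L₁ w = b w • orderReversal 2) :
    ∃ γ : ℝ, 1 < γ ∧
      IsGLB {x : ℝ | ∃ Q : ℂ → Matrix (Fin 2) (Fin 2) ℂ, InRAMat Q ∧ DiagOnDisc Q ∧
        x = hinfNorm fun w => L₀ w + L₁ w * Q w} γ ∧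
      IsLeast {x : ℝ | ∃ Q : ℂ → Matrix (Fin 2) (Fin 2) ℂ, InHinfMat Q ∧ DiagOnDisc Q ∧
        x = hinfNorm fun w => L₀ w + L₁ w * Q w} γ ∧
      ∃ S p : ℂ → ℂ, InA S ∧ InRA p ∧
        (¬ ∃ c : ℂ, ∀ w ∈ Metric.ball (0 : ℂ) 1, p w = c) ∧
        (∀ w ∈ Metric.sphere (0 : ℂ) 1, ‖p w‖ = 1) ∧
        (∀ w ∈ Metric.ball (0 : ℂ) 1, a w + b w * S w = lensMap γ (p w)) ∧
        ∀ Q : ℂ → Matrix (Fin 2) (Fin 2) ℂ,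
          (InHinfMat Q ∧ DiagOnDisc Q ∧ (hinfNorm fun w => L₀ w + L₁ w * Q w) = γ) ↔
            ∀ w ∈ Metric.ball (0 : ℂ) 1, Q w = S w • (1 : Matrix (Fin 2) (Fin 2) ℂ) := by
  have haH := ha.1.1
  have hbH := hb.1.1
  obtain ⟨γ, q₀, hq₀, hmin⟩ := exists_minimizer haH.2.1 hb.1.2 hbT
  have hqf := hq₀.symmetrize haH.2.2 hbH.2.2
  set q : ℂ → ℂ := fun w => (q₀ w + conj (q₀ (conj w))) / 2 with hq
  have hqH : InHinf q := hqf.inHinf haH.2.1 hb.1.2 hbT fun w hw => by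
    simp only [hq, map_div₀, map_add, Complex.conj_conj, map_ofNat]
    ring
  obtain ⟨hγ, p, hp, hpnc, hpT, hpb, hfp⟩ :=
    minimizer_eq_lensMap_comp ha hb hbT hab hmin hqH hqf
  have hpc := mapsTo_closedBall_of_unimodular hpT hpb
  obtain ⟨S, hS, hSq⟩ := exists_inA_of_continuousOn ha.1.2 hb.1.2 hbT hqH
    ((continuousOn_lensExt hγ).comp hp.1.2 hpc) fun w hw => by
      rw [hfp w hw, Function.comp_apply, lensExt_eq_of_mem_ball hγ (hpb w hw)]
  have hSf : IsFeasible a b γ S := ⟨hS.1.1, fun w hw => by rw [hSq w hw]; exact hqf.2 w hw⟩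
  have hlow : ∀ Q : ℂ → Matrix (Fin 2) (Fin 2) ℂ, InHinfMat Q → DiagOnDisc Q →
      γ ≤ hinfNorm fun w => L₀ w + L₁ w * Q w := fun Q h1 h2 =>
    hmin _ _ (isFeasible_hinfNorm haH hbH hL₀ hL₁ h1 h2)
  have hback : ∀ Q : ℂ → Matrix (Fin 2) (Fin 2) ℂ,
      (∀ w ∈ ball (0 : ℂ) 1, Q w = S w • (1 : Matrix (Fin 2) (Fin 2) ℂ)) →
      InHinfMat Q ∧ DiagOnDisc Q ∧ (hinfNorm fun w => L₀ w + L₁ w * Q w) = γ := by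
    intro Q hQ
    have h1 := inHinfMat_smul_one hS.1 hQ
    have h2 : DiagOnDisc Q := fun w hw => by rw [hQ w hw]; exact isDiag_smul_one _
    exact ⟨h1, h2, le_antisymm (hinfNorm_le hL₀ hL₁ hSf hQ) (hlow Q h1 h2)⟩
  refine ⟨γ, hγ, ⟨?_, ?_⟩, ⟨?_, ?_⟩, S, p, hS, hp, hpnc, hpT, ?_, fun Q => ⟨?_, hback Q⟩⟩
  · rintro _ ⟨Q, h1, h2, rfl⟩
    exact hlow Q h1.inHinfMat h2
  · intro x hx
    refine le_of_forall_pos_le_add fun ε hε => ?_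
    obtain ⟨C, hC⟩ := hbH.2.1
    have hC0 : 0 ≤ C := (norm_nonneg _).trans (hC 0 (by simp))
    -- `C + 1` bounds b and is nonzero, so replacing S by T moves f by at most ε.
    obtain ⟨T, hTs, hT⟩ := exists_polynomial_approx hS (ε := ε / (C + 1)) (by positivity)
    refine (hx ⟨fun w => T.eval w • 1, inRAMat_smul_one (inRA_polynomial hTs),
      fun w _ => isDiag_smul_one _, rfl⟩).trans
      (hinfNorm_le hL₀ hL₁ (S := fun w => T.eval w) ⟨by fun_prop, fun w hw => ?_⟩ fun w _ => rfl)
    obtain ⟨h1, h2⟩ := hSf.2 w hw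
    have h3 : ‖b w * (S w - T.eval w)‖ ≤ ε := by
      rw [norm_mul]
      calc ‖b w‖ * ‖S w - T.eval w‖ ≤ (C + 1) * (ε / (C + 1)) :=
            mul_le_mul ((hC w hw).trans (by linarith)) (hT w hw) (norm_nonneg _) (by positivity)
        _ = ε := by field_simp
    constructor
    · rw [show 1 + (a w + b w * T.eval w) =
        (1 + (a w + b w * S w)) - b w * (S w - T.eval w) by ring]
      exact (norm_sub_le _ _).trans (add_le_add h1 h3)
    · rw [show 1 - (a w + b w * T.eval w) =
        (1 - (a w + b w * S w)) + b w * (S w - T.eval w) by ring]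
      exact (norm_add_le _ _).trans (add_le_add h2 h3)
  · obtain ⟨h1, h2, h3⟩ := hback (fun w => S w • 1) fun _ _ => rfl
    exact ⟨_, h1, h2, h3.symm⟩
  · rintro _ ⟨Q, h1, h2, rfl⟩
    exact hlow Q h1 h2
  · intro w hw
    rw [hSq w hw]
    exact hfp w hw
  · rintro ⟨h1, h2, h3⟩ w hw
    have h4 := (mean_square_le_hinfNorm haH hbH hL₀ hL₁ h1 h2).2
    rw [h3] at h4
    have hγ0 : 0 ≤ γ := by linarith
    -- The two diagonal entries of Q obey the mean square bound together and so coincide; their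
    -- common value is then compared with S.
    have h5 := eq_of_mean_square_le ha hb hbT hab hmin hγ0 (h1 0 0) (h1 1 1) h4
    have h6 := eq_of_mean_square_le ha hb hbT hab hmin hγ0 (h1 0 0) hS.1 (fun v hv => by
      obtain ⟨h7, h8⟩ := h4 v hv
      obtain ⟨h9, h10⟩ := hSf.2 v hv
      rw [← h5 v hv] at h7 h8
      have h11 := pow_le_pow_left₀ (norm_nonneg _) h9 2
      have h12 := pow_le_pow_left₀ (norm_nonneg _) h10 2
      constructor <;> linarith)
    have h00 := h6 w hw
    have h11 := h5 w hw
    have h01 : Q w 0 1 = 0 := h2 w hw (by decide)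
    have h10 : Q w 1 0 = 0 := h2 w hw (by decide)
    ext i j
    fin_cases i <;> fin_cases j <;> simp [h00, ← h11, h01, h10]

end
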